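/- Let $k_0$ be a perfect field of characteristic $p>0$ and let $K$ be a finitely generated field extension of $k_0$ (equivalently, the function field of an integral, smooth, quasi-projective $k_0$-scheme). Write $F_K:\operatorname{Spec}K\to\operatorname{Spec}K$ for the absolute Frobenius, $K^{[1]}$ for the field $K$ regarded as a $k_0$-algebra via $c\mapsto c^p$, and $\Omega_{F_K}$ for the differentials of $F_K$, i.e. of $K^{[1]}$ over $K$ via $x\mapsto x^p$. Let $\Gamma$ be a commutative finite group scheme of height one over $K$ (that is, its relative Frobenius $\Gamma\to\Gamma^{(p)}$ is trivial), let $\omega_\Gamma=\epsilon^*\Omega_{\Gamma/K}$ be its co-Lie algebra, where $\epsilon$ is the unit section, and let $H^1(K,\Gamma)$ be the set of isomorphism classes of $\Gamma$-torsors over $\operatorname{Spec}K$. Then: 1. The natural map $\Omega_{K^{[1]}/k_0}\to\Omega_{F_K}$ is an isomorphism. 2. For every $\Gamma$-torsor $\lambda:P\to\operatorname{Spec}K$ there is a unique morphism $\sigma:\operatorname{Spec}K\to P$ with $\lambda\circ\sigma=F_K$, and the orbit map $F_K^*\Gamma\to F_K^*P$, $\gamma\mapsto\sigma\gamma$, induces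 an isomorphism $\theta_P:\sigma^*\Omega_{P/K}\to F_K^*\omega_\Gamma$. 3. $H^1(K,\Gamma)$ is a commutative group whose addition is characterized by: $[P]+[P']=[Q]$ if and only if $Q$ is isomorphic to the contracted product of $P$ and $P'$, i.e. to the quotient of $P\times_K P'$ by the action $\gamma\cdot(x,x')=(\gamma x,\gamma^{-1}x')$ of $\Gamma$, with the action of $\Gamma$ induced by that on $P$. 4. There is a canonical injective homomorphism of groups $$\Phi_\Gamma:H^1(K,\Gamma)\hookrightarrow\operatorname{Hom}_K\bigl(F_K^*(\omega_\Gamma),\Omega_{K^{[1]}/k_0}\bigr),$$ determined by the following description: for every torsor $P$ with its $\sigma$ as in 2, the composite of $\Phi_\Gamma([P])\circ\theta_P$ with the isomorphism of 1 is the morphism of differentials $\sigma^*\Omega_{P/K}\to\Omega_{F_K}$ induced by $\sigma$. -/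

import Mathlib

open scoped TensorProduct

universe u

/-! ### The Frobenius twist `K^[1]` -/

/-- The field `K^[1]`: the field `K`, but regarded as an algebra over a field `S` through the
structure map of `K` composed with Frobenius (see the `Algebra` instance below). -/
def FrobTwist (_p : ℕ) (K : Type u) : Type u := K

namespace FrobTwist

variable (p : ℕ) (K : Type u) [Field K]

instance : Field (FrobTwist p K) := inferInstanceAs (Field K)

/-- The structure map `S → K^[1]` is `s ↦ s ^ p`. For `S = k₀` this is the `k₀`-algebra structure
of `K^[1]`, i.e. `k₀ → K` precomposed with the Frobenius of `k₀`. For `S = K` the structure map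
`K → K^[1]` is the absolute Frobenius `F_K` of `K`, so that `K^[1] ⊗[K] M` is `F_K^* M` and
`Ω[K^[1]⁄K]` is `Ω_{F_K}`. -/
noncomputable instance {S : Type*} [Field S] [Algebra S K] [Fact p.Prime] [CharP K p] :
    Algebra S (FrobTwist p K) :=
  RingHom.toAlgebra (S := FrobTwist p K) ((frobenius K p).comp (algebraMap S K))

instance {k₀ : Type*} [Field k₀] [Algebra k₀ K] [Fact p.Prime] [CharP K p] :
    IsScalarTower k₀ K (FrobTwist p K) :=
  IsScalarTower.of_algebraMap_eq fun _ => rfl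

end FrobTwist

/-! ### Differentials pulled back along a point -/

section PullbackDiff

variable {K B L : Type*} [Field K] [CommRing B] [Algebra K B] [CommRing L] [Algebra K L]

/-- For a morphism `φ : Spec L → Spec B` of `K`-schemes, the `L`-module `φ^* Ω_{B/K}`. -/
def PullbackDiff (φ : B →ₐ[K] L) : Type _ :=
  letI := φ.toRingHom.toAlgebra
  L ⊗[B] Ω[B⁄K]

namespace PullbackDiff

variable (φ : B →ₐ[K] L)

noncomputable instance : AddCommGroup (PullbackDiff φ) :=
  letI := φ.toRingHom.toAlgebra
  (inferInstance : AddCommGroup (L ⊗[B] Ω[B⁄K]))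

noncomputable instance : Module L (PullbackDiff φ) :=
  letI := φ.toRingHom.toAlgebra
  (inferInstance : Module L (L ⊗[B] Ω[B⁄K]))

/-- The element `l ⊗ db` of `φ^* Ω_{B/K}`. -/
noncomputable def mk (l : L) (b : B) : PullbackDiff φ :=
  letI := φ.toRingHom.toAlgebra
  (l ⊗ₜ[B] KaehlerDifferential.D K B b : L ⊗[B] Ω[B⁄K])

/-- The morphism of differentials `φ^* Ω_{B/K} → Ω_{L/K}` induced by `φ`,
`l ⊗ db ↦ l • d(φ b)`. -/
noncomputable def toDiff : PullbackDiff φ →ₗ[L] Ω[L⁄K] :=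
  letI := φ.toRingHom.toAlgebra
  haveI : IsScalarTower K B L := IsScalarTower.of_algebraMap_eq fun x => (φ.commutes x).symm
  KaehlerDifferential.mapBaseChange K B L

theorem toDiff_mk (l : L) (b : B) :
    toDiff φ (mk φ l b) = l • KaehlerDifferential.D K L (φ b) := by
  let := φ.toRingHom.toAlgebra
  have : IsScalarTower K B L := IsScalarTower.of_algebraMap_eq fun x => (φ.commutes x).symm
  exact (KaehlerDifferential.mapBaseChange_tmul K B L l _).trans
    (congrArg (l • ·) (KaehlerDifferential.map_D K K B L b))

/-- `l ⊗ d(b c) = l φ(b) ⊗ dc + l φ(c) ⊗ db`. -/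
theorem mk_mul (l : L) (b c : B) :
    mk φ l (b * c) = φ b • mk φ l c + φ c • mk φ l b := by
  let := φ.toRingHom.toAlgebra
  have h : ∀ x y : B, (l ⊗ₜ[B] (x • KaehlerDifferential.D K B y) : L ⊗[B] Ω[B⁄K]) =
      φ x • (l ⊗ₜ[B] KaehlerDifferential.D K B y) := fun x y => by
    rw [TensorProduct.tmul_smul, TensorProduct.smul_tmul', TensorProduct.smul_tmul']
    rfl
  have h' : (l ⊗ₜ[B] KaehlerDifferential.D K B (b * c) : L ⊗[B] Ω[B⁄K]) =
      φ b • (l ⊗ₜ[B] KaehlerDifferential.D K B c) +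
      φ c • (l ⊗ₜ[B] KaehlerDifferential.D K B b) := by
    rw [Derivation.leibniz, TensorProduct.tmul_add, h, h]
  exact h'

/-- A `K`-linear map `D : B → M` into an `L`-module which is a derivation along `φ` induces the
`L`-linear map `φ^* Ω_{B/K} → M`, `l ⊗ db ↦ l • D b`. -/
noncomputable def lift {M : Type*} [AddCommGroup M] [Module K M] [Module L M]
    [IsScalarTower K L M] (D : B →ₗ[K] M)
    (hD : ∀ b c, D (b * c) = φ b • D c + φ c • D b) : PullbackDiff φ →ₗ[L] M :=
  letI := φ.toRingHom.toAlgebra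
  letI : Module B M := Module.compHom M φ.toRingHom
  haveI : IsScalarTower K B L := IsScalarTower.of_algebraMap_eq fun x => (φ.commutes x).symm
  haveI : IsScalarTower B L M := IsScalarTower.of_algebraMap_smul fun _ _ => rfl
  haveI : IsScalarTower K B M := IsScalarTower.of_algebraMap_smul fun k m => by
    change φ (algebraMap K B k) • m = k • m
    rw [φ.commutes, algebraMap_smul]
  let D' : Derivation K B M := Derivation.mk' D hD
  LinearMap.liftBaseChange L D'.liftKaehlerDifferential

theorem lift_mk {M : Type*} [AddCommGroup M] [Module K M] [Module L M]
    [IsScalarTower K L M] (D : B →ₗ[K] M)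
    (hD : ∀ b c, D (b * c) = φ b • D c + φ c • D b) (l : L) (b : B) :
    lift φ D hD (mk φ l b) = l • D b := by
  let := φ.toRingHom.toAlgebra
  let : Module B M := Module.compHom M φ.toRingHom
  have : IsScalarTower K B L := IsScalarTower.of_algebraMap_eq fun x => (φ.commutes x).symm
  have : IsScalarTower B L M := IsScalarTower.of_algebraMap_smul fun _ _ => rfl
  have : IsScalarTower K B M := IsScalarTower.of_algebraMap_smul fun k m => by
    change φ (algebraMap K B k) • m = k • m
    rw [φ.commutes, algebraMap_smul]
  let D' : Derivation K B M := Derivation.mk' D hD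
  exact (LinearMap.liftBaseChange_tmul L D'.liftKaehlerDifferential l _).trans
    (congrArg (l • ·) (Derivation.liftKaehlerDifferential_comp_D D' b))

end PullbackDiff

end PullbackDiff

/-! ### Finite group schemes of height one

An affine group scheme `Γ = Spec A` over a field `K` is given by a commutative Hopf algebra `A`
over `K`; it is commutative if and only if `A` is cocommutative. -/

/-- The finite group scheme `Γ = Spec A` over `K` is of height one: it is finite (flatness over a
field is automatic) and its relative Frobenius `Γ → Γ^(p)` is the trivial homomorphism. On
coordinate rings the relative Frobenius is `A^(p) = K ⊗_{F_K} A → A`, `x ⊗ a ↦ x a ^ p`, and the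
trivial homomorphism is `x ⊗ a ↦ x ε(a) ^ p`, where `ε` is the counit. -/
structure IsHeightOne (p : ℕ) (K A : Type*) [Field K] [CommRing A] [HopfAlgebra K A] : Prop where
  finite : Module.Finite K A
  frobenius_trivial : ∀ a : A, a ^ p = algebraMap K A (Coalgebra.counit (R := K) a ^ p)

/-- The co-Lie algebra `ω_Γ = ε^* Ω_{Γ/K}` of `Γ = Spec A`, where `ε` is the unit section. -/
abbrev CoLie (K A : Type*) [Field K] [CommRing A] [HopfAlgebra K A] : Type _ :=
  PullbackDiff (Bialgebra.counitAlgHom K A)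

/-- The differential at the unit section, `A → ω_Γ`, `a ↦ 1 ⊗ da`. -/
noncomputable def CoLie.d (K A : Type*) [Field K] [CommRing A] [HopfAlgebra K A] :
    A →ₗ[K] CoLie K A where
  toFun a := PullbackDiff.mk _ 1 a
  map_add' a b := by
    let := (Bialgebra.counitAlgHom K A).toRingHom.toAlgebra
    have h : ((1 : K) ⊗ₜ[A] KaehlerDifferential.D K A (a + b) : K ⊗[A] Ω[A⁄K]) =
        1 ⊗ₜ[A] KaehlerDifferential.D K A a + 1 ⊗ₜ[A] KaehlerDifferential.D K A b := by
      rw [map_add, TensorProduct.tmul_add]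
    exact h
  map_smul' k a := by
    let := (Bialgebra.counitAlgHom K A).toRingHom.toAlgebra
    have : IsScalarTower K A K := IsScalarTower.of_algebraMap_eq
      fun x => ((Bialgebra.counitAlgHom K A).commutes x).symm
    have h : ((1 : K) ⊗ₜ[A] KaehlerDifferential.D K A (k • a) : K ⊗[A] Ω[A⁄K]) =
        k • ((1 : K) ⊗ₜ[A] KaehlerDifferential.D K A a) := by
      rw [Derivation.map_smul, TensorProduct.tmul_smul]
    exact h

/-! ### Torsors -/

/-- A torsor `P = Spec B` over `Spec K` under `Γ = Spec A`: a non-empty scheme `P` (non-emptiness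
means that `P → Spec K` is faithfully flat) with an action `P × Γ → P` of `Γ` such that
`P × Γ → P × P`, `(x, γ) ↦ (x, x γ)` is an isomorphism. All such `P` are affine, since `Γ` is. -/
structure GroupTorsor (K A : Type u) [Field K] [CommRing A] [HopfAlgebra K A] where
  /-- The coordinate ring `B` of the torsor. -/
  carrier : Type u
  [commRing : CommRing carrier]
  [algebra : Algebra K carrier]
  [nontrivial : Nontrivial carrier]
  /-- The action `P × Γ → P` on coordinate rings. -/
  coaction : carrier →ₐ[K] carrier ⊗[K] A
  /-- `(x γ) γ' = x (γ γ')`. -/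
  coaction_coassoc :
    (Algebra.TensorProduct.assoc K K K carrier A A).toAlgHom.comp
        ((Algebra.TensorProduct.map coaction (AlgHom.id K A)).comp coaction) =
      (Algebra.TensorProduct.map (AlgHom.id K carrier) (Bialgebra.comulAlgHom K A)).comp coaction
  /-- `x 1 = x`. -/
  coaction_counit :
    (Algebra.TensorProduct.rid K K carrier).toAlgHom.comp
        ((Algebra.TensorProduct.map (AlgHom.id K carrier) (Bialgebra.counitAlgHom K A)).comp
          coaction) = AlgHom.id K carrier
  /-- `(x, γ) ↦ (x, x γ)` is an isomorphism. -/
  bijective_shear : Function.Bijective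
    (Algebra.TensorProduct.lift (Algebra.TensorProduct.includeLeft : carrier →ₐ[K] carrier ⊗[K] A)
      coaction (fun _ _ => Commute.all _ _))

namespace GroupTorsor

variable {K A : Type u} [Field K] [CommRing A] [HopfAlgebra K A]

instance : CoeSort (GroupTorsor K A) (Type u) := ⟨carrier⟩

instance (P : GroupTorsor K A) : CommRing P := P.commRing
instance (P : GroupTorsor K A) : Algebra K P := P.algebra
instance (P : GroupTorsor K A) : Nontrivial P := P.nontrivial

/-- Two torsors are isomorphic if there is a `Γ`-equivariant isomorphism of `K`-schemes. -/
def Iso (P Q : GroupTorsor K A) : Prop :=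
  ∃ e : P ≃ₐ[K] Q, Q.coaction.comp e.toAlgHom =
    (Algebra.TensorProduct.map e.toAlgHom (AlgHom.id K A)).comp P.coaction

/-- Isomorphism of torsors is an equivalence relation. -/
instance setoid (K A : Type u) [Field K] [CommRing A] [HopfAlgebra K A] :
    Setoid (GroupTorsor K A) where
  r := Iso
  iseqv :=
    { refl := fun P => ⟨AlgEquiv.refl, by
        ext x
        change P.coaction x =
          Algebra.TensorProduct.map (AlgHom.id K P) (AlgHom.id K A) (P.coaction x)
        rw [Algebra.TensorProduct.map_id]; rfl⟩
      symm := by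
        rintro P Q ⟨e, he⟩
        have h1 : e.symm.toAlgHom.comp e.toAlgHom = AlgHom.id K P :=
          AlgHom.ext fun z => e.symm_apply_apply z
        have h2 : e.toAlgHom.comp e.symm.toAlgHom = AlgHom.id K Q :=
          AlgHom.ext fun z => e.apply_symm_apply z
        refine ⟨e.symm, ?_⟩
        calc P.coaction.comp e.symm.toAlgHom
            = ((Algebra.TensorProduct.map e.symm.toAlgHom (AlgHom.id K A)).comp
                ((Algebra.TensorProduct.map e.toAlgHom (AlgHom.id K A)).comp P.coaction)).comp
                  e.symm.toAlgHom := by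
              rw [← AlgHom.comp_assoc, ← Algebra.TensorProduct.map_comp, h1, AlgHom.comp_id,
                Algebra.TensorProduct.map_id, AlgHom.id_comp]
          _ = _ := by
              rw [← he, AlgHom.comp_assoc, AlgHom.comp_assoc, h2, AlgHom.comp_id]
      trans := by
        rintro P Q R ⟨e, he⟩ ⟨f, hf⟩
        refine ⟨e.trans f, ?_⟩
        have h1 : (e.trans f).toAlgHom = f.toAlgHom.comp e.toAlgHom := rfl
        rw [h1, ← AlgHom.comp_assoc, hf, AlgHom.comp_assoc, he, ← AlgHom.comp_assoc,
          ← Algebra.TensorProduct.map_comp, AlgHom.comp_id] }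

/-- The set `H¹(K, Γ)` of isomorphism classes of torsors over `Spec K` under `Γ = Spec A`. -/
def H1 (K A : Type u) [Field K] [CommRing A] [HopfAlgebra K A] : Type (u + 1) :=
  Quotient (setoid K A)

/-- The class of a torsor in `H¹(K, Γ)`. -/
def toH1 (P : GroupTorsor K A) : H1 K A := Quotient.mk (setoid K A) P

/-- The morphism `P × P' × Γ → P × P'`, `(x, x', γ) ↦ (x, x' γ)`, on coordinate rings. -/
def actSnd (P P' : GroupTorsor K A) : P ⊗[K] P' →ₐ[K] (P ⊗[K] P') ⊗[K] A :=
  (Algebra.TensorProduct.assoc K K K P P' A).symm.toAlgHom.comp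
    (Algebra.TensorProduct.map (AlgHom.id K P) P'.coaction)

/-- The morphism `P × P' × Γ → P × P'`, `(x, x', γ) ↦ (x γ, x')`, on coordinate rings. -/
def actFst (P P' : GroupTorsor K A) : P ⊗[K] P' →ₐ[K] (P ⊗[K] P') ⊗[K] A :=
  (Algebra.TensorProduct.map (Algebra.TensorProduct.comm K P' P).toAlgHom (AlgHom.id K A)).comp
    ((actSnd P' P).comp (Algebra.TensorProduct.comm K P P').toAlgHom)

/-- `Q` is the sum (contracted product) of the torsors `P` and `P'` under the commutative group
scheme `Γ`: the quotient of `P × P'` by the action `γ (x, x') = (x γ, x' γ⁻¹)`, with the action of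
`Γ` induced by its action on `P`. That is, there is a morphism `q : P × P' → Q` which identifies
the coordinate ring of `Q` with the ring of invariant functions, and is equivariant for the action
of `Γ` on the first factor. Substituting `x' γ` for `x'`, a function `f` on `P × P'` is invariant
if and only if `f (x γ, x') = f (x, x' γ)`. -/
def IsSum (P P' Q : GroupTorsor K A) : Prop :=
  ∃ q : Q →ₐ[K] P ⊗[K] P',
    Function.Injective q ∧
    (∀ t : P ⊗[K] P', t ∈ q.range ↔ actFst P P' t = actSnd P P' t) ∧
    (actFst P P').comp q = (Algebra.TensorProduct.map q (AlgHom.id K A)).comp Q.coaction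

/-! ### The trivialization of differentials of a torsor along a point -/

section Trivialization

variable {L : Type u} [CommRing L] [Algebra K L]

/-- For an `L`-valued point `σ : Spec L → P`, the orbit map `Γ_L → P`, `γ ↦ σ γ`, on coordinate
rings. -/
def orbitMap (P : GroupTorsor K A) (σ : P →ₐ[K] L) : P →ₐ[K] L ⊗[K] A :=
  (Algebra.TensorProduct.map σ (AlgHom.id K A)).comp P.coaction

/-- The differential `b ↦ d(b(σ γ))` at the unit section `γ = 1` of the pullback of functions
along the orbit map. -/
noncomputable def orbitD (P : GroupTorsor K A) (σ : P →ₐ[K] L) : P →ₗ[K] L ⊗[K] CoLie K A :=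
  (LinearMap.lTensor L (CoLie.d K A)).comp (P.orbitMap σ).toLinearMap

theorem lTensor_coLie_d_mul (x y : L ⊗[K] A) :
    LinearMap.lTensor L (CoLie.d K A) (x * y) =
      Algebra.TensorProduct.rid K L L
          (Algebra.TensorProduct.map (AlgHom.id L L) (Bialgebra.counitAlgHom K A) x) •
        LinearMap.lTensor L (CoLie.d K A) y +
      Algebra.TensorProduct.rid K L L
          (Algebra.TensorProduct.map (AlgHom.id L L) (Bialgebra.counitAlgHom K A) y) •
        LinearMap.lTensor L (CoLie.d K A) x := by
  have hd : ∀ a b : A, CoLie.d K A (a * b) =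
      Bialgebra.counitAlgHom K A a • CoLie.d K A b +
      Bialgebra.counitAlgHom K A b • CoLie.d K A a :=
    fun a b => PullbackDiff.mk_mul _ 1 a b
  induction x using TensorProduct.induction_on with
  | zero => simp
  | add x₁ x₂ h₁ h₂ => simp only [add_mul, map_add, h₁, h₂, add_smul, smul_add]; abel
  | tmul l a =>
    induction y using TensorProduct.induction_on with
    | zero => simp
    | add y₁ y₂ h₁ h₂ => simp only [mul_add, map_add, h₁, h₂, add_smul, smul_add]; abel
    | tmul m b =>
      simp only [Algebra.TensorProduct.tmul_mul_tmul, LinearMap.lTensor_tmul, hd,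
        TensorProduct.tmul_add, Algebra.TensorProduct.map_tmul, AlgHom.id_apply,
        Algebra.TensorProduct.rid_tmul, TensorProduct.smul_tmul', smul_eq_mul,
        TensorProduct.tmul_smul, smul_mul_assoc]
      rw [mul_comm m l]

theorem orbitD_mul (P : GroupTorsor K A) (σ : P →ₐ[K] L) (b c : P) :
    P.orbitD σ (b * c) = σ b • P.orbitD σ c + σ c • P.orbitD σ b := by
  have h : ∀ b : P, Algebra.TensorProduct.rid K L L
      (Algebra.TensorProduct.map (AlgHom.id L L) (Bialgebra.counitAlgHom K A)
        (P.orbitMap σ b)) = σ b := fun b => by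
    have h1 : ∀ x : P ⊗[K] A, Algebra.TensorProduct.rid K L L
        (Algebra.TensorProduct.map (AlgHom.id L L) (Bialgebra.counitAlgHom K A)
          (Algebra.TensorProduct.map σ (AlgHom.id K A) x)) =
        σ (Algebra.TensorProduct.rid K K P
          (Algebra.TensorProduct.map (AlgHom.id K P) (Bialgebra.counitAlgHom K A) x)) := by
      intro x
      induction x using TensorProduct.induction_on with
      | zero => simp
      | add x y hx hy => simp only [map_add, hx, hy]
      | tmul x a => simp
    exact (h1 _).trans (congrArg σ (DFunLike.congr_fun P.coaction_counit b))
  have h2 := lTensor_coLie_d_mul (P.orbitMap σ b) (P.orbitMap σ c)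
  rw [h, h, ← map_mul] at h2
  exact h2

/-- The morphism `σ^* Ω_{P/K} → ω_Γ ⊗ L` (in fact an isomorphism) induced by the orbit map
`Γ_L → P`, `γ ↦ σ γ`, which sends the unit section to `σ`: the pullback of differentials along
the orbit map, evaluated at the unit section. For `L = K^[1]`, the target is `F_K^* ω_Γ`. -/
noncomputable def trivialization (P : GroupTorsor K A) (σ : P →ₐ[K] L) :
    PullbackDiff σ →ₗ[L] L ⊗[K] CoLie K A :=
  PullbackDiff.lift σ (P.orbitD σ) (P.orbitD_mul σ)

end Trivialization

end GroupTorsor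

/-!
Write `L = K^[1]` and let `F : K → L` be the Frobenius.

Differentials: `d (x ^ p) = 0`, so `Ω_{L/k₀} → Ω_{L/K}` is bijective. Conversely an element `x` of
`L` with `dx = 0` in `Ω_{L/K}` lies in `K`
(`KaehlerDifferential.mem_range_algebraMap_of_D_eq_zero`).

The point `σ`: since `Γ` has height one, the coaction `c : B → B ⊗ A` of a torsor `P = Spec B`
satisfies `c(b) ^ p = b ^ p ⊗ 1`. The shear isomorphism turns this into `1 ⊗ b ^ p = b ^ p ⊗ 1` in
`B ⊗ B`, whence `b ^ p ∈ K`. Regarded as an element of `L`, it is the value at `b` of the unique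
`K`-homomorphism `σ : B → L` (`GroupTorsor.exists_unique_section`). The base change of the shear
isomorphism along `σ` is an isomorphism `L ⊗ B ≃ L ⊗ A`, the orbit map of `σ`, and the
trivialization `σ^* Ω_{B/K} ≃ L ⊗ ω_Γ` is its differential at the unit section. So there is a unique `L`-linear
`ξ_P : L ⊗ ω_Γ → Ω_{L/K}` (`GroupTorsor.differential`) sending the differential of the orbit map at
`b` to `d(σ b)`.

Injectivity: the orbit map embeds `B` in `L ⊗ A`, and the `L`-span of its image is everything. On
that image `d ⊗ 1 : L ⊗ A → Ω_{L/K} ⊗ A` agrees with an `L`-linear map `E` which depends on `ξ_P`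
only: `ξ_P` composed with the translation-invariant differential of `A`. In other words `d ⊗ 1 - E`
is a connection on `L ⊗ A` which is trivialized by a `K`-basis of `B`; because the constants of `d`
are `K`, its horizontal elements are exactly the image of `B`. Hence `ξ_P` determines this image,
and with it the torsor (`GroupTorsor.iso_of_differential_eq`).

Sums: if `Q` is the contracted product of `P` and `P'`, then `ξ_Q = ξ_P + ξ_P'` by the Leibniz rule
(`GroupTorsor.differential_of_isSum`). Contracted products exist (`GroupTorsor.exists_isSum`): the
ring of invariants in `B ⊗ B'` becomes `L ⊗ B'` over `L`, by restriction to `{σ} × P'`, and being a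
torsor may be tested over `L` (`bijective_shear_of_orbitBaseChange`). So `P ↦ ξ_P` is an injection
of `H¹` into a vector space of characteristic `p` whose image is non-empty and closed under
addition, that is, a subgroup; the group structure of `H¹` is the one of the image.
-/

/-! ### Descent of elements and of constants along field extensions -/

/-- Descent of elements along `K → B`: an element equalized by the two maps `B → B ⊗[K] B` lies
in `K`. -/
theorem mem_range_algebraMap_of_tmul_one_eq {K B : Type*} [Field K] [CommRing B] [Algebra K B]
    [Nontrivial B] {b : B} (h : (1 : B) ⊗ₜ[K] b = b ⊗ₜ[K] (1 : B)) :
    b ∈ Set.range (algebraMap K B) := by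
  by_contra hb
  have hb' : b ∉ Submodule.span K {(1 : B)} := by
    intro hm
    obtain ⟨c, rfl⟩ := Submodule.mem_span_singleton.mp hm
    exact hb ⟨c, Algebra.algebraMap_eq_smul_one c⟩
  obtain ⟨f, hf, hf'⟩ := Submodule.exists_le_ker_of_notMem hb'
  have h1 : f 1 = 0 := hf' (Submodule.mem_span_singleton_self 1)
  have := congrArg (TensorProduct.rid K B ∘ LinearMap.lTensor B f) h
  simp [h1] at this
  exact hf this

/-- If `L ^ p ⊆ K ⊆ L`, the constants of `d : L → Ω_{L/K}` are the elements of `K`. For `x ∉ K`, an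
intermediate field `M` maximal among those not containing `x` satisfies `L = M(x)`; if `dx` were
`0`, then `Ω_{L/M} = 0`, so that `L = M` because `L / M` is both unramified and purely
inseparable. -/
theorem KaehlerDifferential.mem_range_algebraMap_of_D_eq_zero (p : ℕ) [Fact p.Prime]
    {K L : Type*} [Field K] [Field L] [Algebra K L] [CharP K p]
    (hp : ∀ x : L, x ^ p ∈ (algebraMap K L).range) {x : L} (hx : KaehlerDifferential.D K L x = 0) :
    x ∈ (algebraMap K L).range := by
  by_contra hxK
  have : ExpChar K p := ExpChar.prime Fact.out
  have hint (y : L) : IsIntegral K y := by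
    refine IsIntegral.of_pow (n := p) (Nat.Prime.pos Fact.out) ?_
    obtain ⟨c, hc⟩ := hp y
    rw [← hc]
    exact isIntegral_algebraMap
  obtain ⟨M, -, hM⟩ := zorn_le_nonempty₀ {M : IntermediateField K L | x ∉ M}
    (fun c hc hch y hy => by
      have hne : Nonempty c := ⟨y, hy⟩
      refine ⟨⨆ M : c, M.1, ?_, fun z hz => le_iSup (fun M : c => M.1) ⟨z, hz⟩⟩
      have hdir : Directed (· ≤ ·) (fun M : c => M.1) := hch.directed
      change x ∉ _
      rw [← SetLike.mem_coe, IntermediateField.coe_iSup_of_directed hdir]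
      simp only [Set.mem_iUnion, not_exists]
      exact fun i => hc i.2) ⊥ (by
        change x ∉ _
        rwa [IntermediateField.mem_bot])
  have hxM : x ∉ M := hM.1
  have hMp (y : L) : y ^ p ∈ (algebraMap M L).range := by
    obtain ⟨c, hc⟩ := hp y
    exact ⟨algebraMap K M c, by rw [← hc]; rfl⟩
  have hintM (y : L) : IsIntegral M y := (hint y).tower_top
  have hdeg (y : L) (hy : y ∉ M) : Module.finrank M (IntermediateField.adjoin M {y}) = p := by
    obtain ⟨a, ha⟩ := hMp y
    have hmin : minpoly M y = Polynomial.X ^ p - Polynomial.C a := by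
      refine (minpoly.eq_of_irreducible_of_monic
        (X_pow_sub_C_irreducible_of_prime Fact.out fun b hb => hy ?_) (by simp [ha])
        (Polynomial.monic_X_pow_sub_C a (Nat.Prime.ne_zero Fact.out))).symm
      have : (b : L) ^ p = y ^ p := by rw [← ha, ← hb, map_pow]; rfl
      have hchar : CharP L p := charP_of_injective_algebraMap (algebraMap K L).injective p
      exact frobenius_inj L p this ▸ b.2
    rw [IntermediateField.adjoin.finrank (hintM y), hmin, Polynomial.natDegree_X_pow_sub_C]
  have htop : IntermediateField.adjoin M {x} = ⊤ := by
    refine eq_top_iff.mpr fun y _ => ?_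
    by_cases hy : y ∈ M
    · exact (IntermediateField.adjoin M {x}).algebraMap_mem ⟨y, hy⟩
    have hxy : x ∈ IntermediateField.adjoin M {y} := by
      by_contra hxy
      have hle : M ≤ (IntermediateField.adjoin M {y}).restrictScalars K := fun z hz =>
        (IntermediateField.adjoin M {y}).algebraMap_mem ⟨z, hz⟩
      exact hy (hM.2 hxy hle (IntermediateField.mem_adjoin_simple_self M y))
    have hfin : FiniteDimensional M (IntermediateField.adjoin M {y}) :=
      IntermediateField.adjoin.finiteDimensional (hintM y)
    rw [IntermediateField.eq_of_le_of_finrank_eq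
      (IntermediateField.adjoin_simple_le_iff.mpr hxy) ((hdeg x hxM).trans (hdeg y hy).symm)]
    exact IntermediateField.mem_adjoin_simple_self M y
  have hess : Algebra.EssFiniteType M L :=
    IntermediateField.fg_top_iff.mp ⟨{x}, by simpa using htop⟩
  have hinsep : IsPurelyInseparable M L :=
    (isPurelyInseparable_iff_pow_mem M p).mpr fun y => ⟨1, by simpa using hMp y⟩
  have hxM0 : KaehlerDifferential.D M L x = 0 := by
    have h := KaehlerDifferential.map_D K M L L x
    rw [hx, map_zero] at h
    exact h.symm
  have hunr : Algebra.FormallyUnramified M L := by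
    refine ⟨(subsingleton_iff_forall_eq 0).mpr fun w => ?_⟩
    have hw := KaehlerDifferential.span_range_derivation M L
    have hD (y : L) : KaehlerDifferential.D M L y = 0 := by
      have hy : y ∈ Algebra.adjoin M {x} := by
        rw [← IntermediateField.adjoin_simple_toSubalgebra_of_isAlgebraic (hintM x).isAlgebraic,
          htop]
        trivial
      exact Derivation.eqOn_adjoin (D1 := KaehlerDifferential.D M L) (D2 := 0)
        (fun z hz => by rw [Set.mem_singleton_iff.mp hz, hxM0]; rfl) hy
    have : w ∈ Submodule.span L (Set.range (KaehlerDifferential.D M L)) := hw ▸ trivial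
    refine (Submodule.mem_bot L).mp (Submodule.span_le.mpr ?_ this)
    rintro _ ⟨y, rfl⟩
    exact hD y
  have hx' : x ∈ (algebraMap M L).range := by
    rw [Algebra.FormallyUnramified.range_eq_top_of_isPurelyInseparable M L]
    trivial
  obtain ⟨m, rfl⟩ := hx'
  exact hxM m.2

/-! ### Differentials of the Frobenius twist -/

namespace FrobTwist

variable (p : ℕ) [Fact p.Prime] {K : Type u} [Field K] [CharP K p]

instance : CharP (FrobTwist p K) p := inferInstanceAs (CharP K p)

theorem pow_mem_range (x : FrobTwist p K) : x ^ p ∈ (algebraMap K (FrobTwist p K)).range :=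
  ⟨(x : K), rfl⟩

/-- The kernel of `Ω_{K^[1]/k₀} → Ω_{K^[1]/K}` is generated by the differentials of elements of
`K`, which are `p`-th powers in `K^[1]`. -/
theorem map_kaehlerDifferential_bijective (k₀ : Type*) [Field k₀] [Algebra k₀ K] :
    Function.Bijective (KaehlerDifferential.map k₀ K (FrobTwist p K) (FrobTwist p K)) := by
  refine ⟨?_, KaehlerDifferential.map_surjective k₀ K (FrobTwist p K)⟩
  rw [← LinearMap.ker_eq_bot, eq_bot_iff]
  intro w hw
  obtain ⟨z, rfl⟩ :=
    (KaehlerDifferential.exact_mapBaseChange_map k₀ K (FrobTwist p K) w).mp hw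
  have hD (x : FrobTwist p K) : KaehlerDifferential.D k₀ (FrobTwist p K) (x ^ p) = 0 := by
    rw [Derivation.leibniz_pow, ← Nat.cast_smul_eq_nsmul (FrobTwist p K), CharP.cast_eq_zero,
      zero_smul]
  have hmap (v : Ω[K⁄k₀]) : KaehlerDifferential.map k₀ k₀ K (FrobTwist p K) v = 0 := by
    have hv : v ∈ Submodule.span K (Set.range (KaehlerDifferential.D k₀ K)) := by
      rw [KaehlerDifferential.span_range_derivation]
      trivial
    refine (Submodule.span_le (p := LinearMap.ker _)).mpr ?_ hv
    rintro _ ⟨x, rfl⟩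
    exact (KaehlerDifferential.map_D k₀ k₀ K (FrobTwist p K) x).trans (hD x)
  induction z using TensorProduct.induction_on with
  | zero => rw [map_zero]; exact Submodule.zero_mem _
  | tmul l v =>
    rw [KaehlerDifferential.mapBaseChange_tmul, hmap, smul_zero]
    exact Submodule.zero_mem _
  | add z z' h h' =>
    rw [map_add]
    refine Submodule.add_mem _ (h ?_) (h' ?_) <;>
      exact (KaehlerDifferential.exact_mapBaseChange_map k₀ K (FrobTwist p K) _).mpr ⟨_, rfl⟩

end FrobTwist

/-! ### The Frobenius point of a torsor -/

namespace GroupTorsor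

variable {K A : Type u} [Field K] [CommRing A] [HopfAlgebra K A]

/-- The isomorphism `B ⊗ B ≃ B ⊗ A`, `b ⊗ c ↦ (b ⊗ 1) * coaction c`, dual to
`(x, γ) ↦ (x, x γ)`. -/
noncomputable def shear (P : GroupTorsor K A) : P ⊗[K] P ≃ₐ[K] P ⊗[K] A :=
  AlgEquiv.ofBijective _ P.bijective_shear

@[simp]
theorem shear_tmul (P : GroupTorsor K A) (b c : P) :
    P.shear (b ⊗ₜ c) = b ⊗ₜ 1 * P.coaction c := rfl

section Frobenius

variable {p : ℕ} [Fact p.Prime] [CharP K p]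

/-- On `P × Γ` with `Γ` of height one, `f ^ p` only depends on the restriction of `f` to
`P × {1}`. -/
theorem pow_eq_tmul_one (hA : IsHeightOne p K A) (P : GroupTorsor K A) (x : P ⊗[K] A) :
    x ^ p = ((Algebra.TensorProduct.rid K K P).toAlgHom.comp
      (Algebra.TensorProduct.map (AlgHom.id K P) (Bialgebra.counitAlgHom K A)) x ^ p) ⊗ₜ[K]
        (1 : A) := by
  have hinj := (algebraMap K P).injective
  have : CharP P p := charP_of_injective_algebraMap hinj p
  have : Nontrivial A := Bialgebra.nontrivial (R := K)
  have : CharP (P ⊗[K] A) p :=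
    charP_of_injective_algebraMap (algebraMap K (P ⊗[K] A)).injective p
  induction x using TensorProduct.induction_on with
  | zero => simp [Nat.Prime.ne_zero (Fact.out : p.Prime)]
  | add x y hx hy => rw [add_pow_char, hx, hy, map_add, add_pow_char, TensorProduct.add_tmul]
  | tmul b a =>
    rw [Algebra.TensorProduct.tmul_pow, hA.frobenius_trivial a, Algebra.algebraMap_eq_smul_one,
      ← TensorProduct.smul_tmul]
    simp [smul_pow]

/-- By the shear isomorphism, `1 ⊗ b ^ p = b ^ p ⊗ 1` in `B ⊗ B`. -/
theorem pow_mem_range_algebraMap (hA : IsHeightOne p K A) (P : GroupTorsor K A) (b : P) :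
    b ^ p ∈ Set.range (algebraMap K P) := by
  refine mem_range_algebraMap_of_tmul_one_eq (P.shear.injective ?_)
  have h := pow_eq_tmul_one hA P (P.coaction b)
  rw [← AlgHom.comp_apply, AlgHom.comp_assoc, P.coaction_counit] at h
  rw [shear_tmul, shear_tmul, map_pow, map_one, mul_one, h, ← Algebra.TensorProduct.one_def,
    one_mul]
  rfl

theorem exists_unique_section (hA : IsHeightOne p K A) (P : GroupTorsor K A) :
    ∃ σ : P →ₐ[K] FrobTwist p K, ∀ τ : P →ₐ[K] FrobTwist p K, τ = σ := by
  choose s hs using pow_mem_range_algebraMap hA P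
  have hinj := (algebraMap K P).injective
  have : CharP P p := charP_of_injective_algebraMap hinj p
  let f : P →+* K :=
    { toFun := s
      map_one' := hinj (by rw [hs, one_pow, map_one])
      map_zero' := hinj (by rw [hs, zero_pow (Nat.Prime.ne_zero Fact.out), map_zero])
      map_mul' := fun b c => hinj (by rw [hs, map_mul, hs, hs, mul_pow])
      map_add' := fun b c => hinj (by rw [hs, map_add, hs, hs, add_pow_char]) }
  refine ⟨{ (f : P →+* FrobTwist p K) with
    commutes' := fun c => hinj ((hs _).trans (map_pow _ _ _).symm) },
    fun τ => AlgHom.ext fun b => ?_⟩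
  refine frobenius_inj (FrobTwist p K) p ?_
  change τ b ^ p = (s b : FrobTwist p K) ^ p
  rw [← map_pow, ← hs, AlgHom.commutes]
  rfl

end Frobenius

end GroupTorsor

/-! ### Generators of the pullback of differentials -/

namespace PullbackDiff

variable {K B L : Type*} [Field K] [CommRing B] [Algebra K B] [CommRing L] [Algebra K L]
  (φ : B →ₐ[K] L)

theorem smul_mk (l m : L) (b : B) : l • mk φ m b = mk φ (l * m) b := rfl

theorem mk_add (l : L) (b c : B) : mk φ l (b + c) = mk φ l b + mk φ l c := by
  let := φ.toRingHom.toAlgebra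
  have h : (l ⊗ₜ[B] KaehlerDifferential.D K B (b + c) : L ⊗[B] Ω[B⁄K]) =
      l ⊗ₜ[B] KaehlerDifferential.D K B b + l ⊗ₜ[B] KaehlerDifferential.D K B c := by
    rw [map_add, TensorProduct.tmul_add]
  exact h

theorem mk_smul (l : L) (k : K) (b : B) : mk φ l (k • b) = algebraMap K L k • mk φ l b := by
  let := φ.toRingHom.toAlgebra
  have : IsScalarTower K B L := IsScalarTower.of_algebraMap_eq fun x => (φ.commutes x).symm
  have h : (l ⊗ₜ[B] KaehlerDifferential.D K B (k • b) : L ⊗[B] Ω[B⁄K]) =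
      algebraMap K L k • (l ⊗ₜ[B] KaehlerDifferential.D K B b) := by
    rw [Derivation.map_smul, TensorProduct.tmul_smul, algebraMap_smul]
  exact h

theorem span_range_mk_one : Submodule.span L (Set.range (mk φ 1)) = ⊤ := by
  let := φ.toRingHom.toAlgebra
  suffices h : ∀ w : L ⊗[B] Ω[B⁄K], w ∈ Submodule.span L (Set.range (mk φ 1)) from
    eq_top_iff.mpr fun w _ => h w
  intro w
  induction w using TensorProduct.induction_on with
  | zero => exact Submodule.zero_mem _
  | add x y hx hy => exact Submodule.add_mem _ hx hy
  | tmul l v =>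
    have hv : v ∈ Submodule.span B (Set.range (KaehlerDifferential.D K B)) := by
      rw [KaehlerDifferential.span_range_derivation]
      trivial
    induction hv using Submodule.span_induction generalizing l with
    | mem v hv =>
      obtain ⟨b, rfl⟩ := hv
      have h : mk φ l b ∈ Submodule.span L (Set.range (mk φ 1)) := by
        rw [← mul_one l, ← smul_mk]
        exact Submodule.smul_mem _ _ (Submodule.subset_span ⟨b, rfl⟩)
      exact h
    | zero => rw [TensorProduct.tmul_zero]; exact Submodule.zero_mem _
    | add v w _ _ hv hw => rw [TensorProduct.tmul_add]; exact Submodule.add_mem _ (hv l) (hw l)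
    | smul b v _ hv =>
      rw [← TensorProduct.smul_tmul]
      exact hv _

theorem linearMap_ext {M : Type*} [AddCommGroup M] [Module L M] {f g : PullbackDiff φ →ₗ[L] M}
    (h : ∀ b, f (mk φ 1 b) = g (mk φ 1 b)) : f = g :=
  LinearMap.ext_on_range (span_range_mk_one φ) h

/-- The `L`-linear map `L ⊗ B → φ^* Ω_{B/K}`, `l ⊗ b ↦ l ⊗ db`. -/
noncomputable def ofTensor : L ⊗[K] B →ₗ[L] PullbackDiff φ :=
  letI : Module K (PullbackDiff φ) := Module.compHom _ (algebraMap K L)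
  haveI : IsScalarTower K L (PullbackDiff φ) := IsScalarTower.of_algebraMap_smul fun _ _ => rfl
  LinearMap.liftBaseChange L
    { toFun := mk φ 1
      map_add' := mk_add φ 1
      map_smul' := mk_smul φ 1 }

@[simp]
theorem ofTensor_tmul (l : L) (b : B) : ofTensor φ (l ⊗ₜ b) = mk φ l b := by
  let : Module K (PullbackDiff φ) := Module.compHom _ (algebraMap K L)
  have : IsScalarTower K L (PullbackDiff φ) := IsScalarTower.of_algebraMap_smul fun _ _ => rfl
  rw [ofTensor, LinearMap.liftBaseChange_tmul]
  change l • mk φ 1 b = _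
  rw [smul_mk, mul_one]

/-- `ofTensor φ` is a derivation along the homomorphism `L ⊗ B → L`, `l ⊗ b ↦ l * φ b`. -/
theorem ofTensor_mul (x y : L ⊗[K] B) : ofTensor φ (x * y) =
    Algebra.TensorProduct.lift (AlgHom.id L L) φ (fun _ _ => Commute.all _ _) x • ofTensor φ y +
    Algebra.TensorProduct.lift (AlgHom.id L L) φ (fun _ _ => Commute.all _ _) y • ofTensor φ x := by
  induction x using TensorProduct.induction_on with
  | zero => simp
  | add x₁ x₂ h₁ h₂ => simp only [add_mul, map_add, h₁, h₂, add_smul, smul_add]; abel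
  | tmul l a =>
    induction y using TensorProduct.induction_on with
    | zero => simp
    | add y₁ y₂ h₁ h₂ => simp only [mul_add, map_add, h₁, h₂, add_smul, smul_add]; abel
    | tmul m b =>
      simp only [Algebra.TensorProduct.tmul_mul_tmul, ofTensor_tmul, mk_mul, smul_mk,
        Algebra.TensorProduct.lift_tmul, AlgHom.id_apply]
      congr 2 <;> ring

end PullbackDiff

/-! ### The orbit map of a point and the trivialization of differentials -/

section Orbit

variable {K A B L : Type*} [Field K] [CommRing A] [HopfAlgebra K A] [CommRing B] [Algebra K B]
  [CommRing L] [Algebra K L]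

/-- For a coaction `c` of `Γ = Spec A` on `Spec B` and an `L`-valued point `σ` of `Spec B`, the
orbit map `Γ_L → (Spec B)_L`, `γ ↦ σ γ`, as an `L`-algebra homomorphism. -/
noncomputable def orbitBaseChange (c : B →ₐ[K] B ⊗[K] A) (σ : B →ₐ[K] L) :
    L ⊗[K] B →ₐ[L] L ⊗[K] A :=
  Algebra.TensorProduct.lift (Algebra.ofId L (L ⊗[K] A))
    ((Algebra.TensorProduct.map σ (AlgHom.id K A)).comp c) (fun _ _ => Commute.all _ _)

@[simp]
theorem orbitBaseChange_tmul (c : B →ₐ[K] B ⊗[K] A) (σ : B →ₐ[K] L) (l : L) (b : B) :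
    orbitBaseChange c σ (l ⊗ₜ b) = l • Algebra.TensorProduct.map σ (AlgHom.id K A) (c b) := by
  rw [orbitBaseChange, Algebra.TensorProduct.lift_tmul, Algebra.smul_def]
  rfl

end Orbit

namespace GroupTorsor

variable {K A : Type u} [Field K] [CommRing A] [HopfAlgebra K A]

section

variable {L : Type u} [CommRing L] [Algebra K L]

theorem orbitMap_apply (P : GroupTorsor K A) (σ : P →ₐ[K] L) (b : P) :
    P.orbitMap σ b = Algebra.TensorProduct.map σ (AlgHom.id K A) (P.coaction b) := rfl

/-- The orbit map of `σ` is the base change along `σ` of the shear isomorphism. -/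
theorem orbitBaseChange_bijective (P : GroupTorsor K A) (σ : P →ₐ[K] L) :
    Function.Bijective (orbitBaseChange P.coaction σ) := by
  let ψ : L ⊗[K] A →ₐ[L] L ⊗[K] P := Algebra.TensorProduct.lift (Algebra.ofId L (L ⊗[K] P))
    (((Algebra.TensorProduct.map σ (AlgHom.id K P)).comp P.shear.symm.toAlgHom).comp
      Algebra.TensorProduct.includeRight) (fun _ _ => Commute.all _ _)
  have hψ (l : L) (a : A) : ψ (l ⊗ₜ a) =
      l • Algebra.TensorProduct.map σ (AlgHom.id K P) (P.shear.symm (1 ⊗ₜ a)) := by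
    simp only [ψ]
    rw [Algebra.TensorProduct.lift_tmul, Algebra.smul_def]
    rfl
  have h1 (t : P ⊗[K] P) : orbitBaseChange P.coaction σ
      (Algebra.TensorProduct.map σ (AlgHom.id K P) t) =
      Algebra.TensorProduct.map σ (AlgHom.id K A) (P.shear t) := by
    induction t using TensorProduct.induction_on with
    | zero => simp
    | add x y hx hy => simp only [map_add, hx, hy]
    | tmul x y => simp [Algebra.smul_def]
  have h2 (t : P ⊗[K] A) : ψ (Algebra.TensorProduct.map σ (AlgHom.id K A) t) =
      Algebra.TensorProduct.map σ (AlgHom.id K P) (P.shear.symm t) := by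
    induction t using TensorProduct.induction_on with
    | zero => simp
    | add x y hx hy => simp only [map_add, hx, hy]
    | tmul x a =>
      have hx : P.shear.symm (x ⊗ₜ 1) = x ⊗ₜ 1 := by
        rw [AlgEquiv.symm_apply_eq, shear_tmul, map_one, mul_one]
      have hxa : P.shear.symm (x ⊗ₜ a) = x ⊗ₜ 1 * P.shear.symm (1 ⊗ₜ a) := by
        rw [← hx, ← map_mul, Algebra.TensorProduct.tmul_mul_tmul, mul_one, one_mul]
      rw [hxa, map_mul, Algebra.TensorProduct.map_tmul, Algebra.TensorProduct.map_tmul, hψ]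
      simp [Algebra.smul_def]
  refine Function.bijective_iff_has_inverse.mpr ⟨ψ, fun t => ?_, fun t => ?_⟩
  · induction t using TensorProduct.induction_on with
    | zero => simp
    | add x y hx hy => simp only [map_add, hx, hy]
    | tmul l b =>
      have : P.shear.symm (P.coaction b) = 1 ⊗ₜ b := by
        rw [AlgEquiv.symm_apply_eq, shear_tmul, ← Algebra.TensorProduct.one_def, one_mul]
      rw [orbitBaseChange_tmul, map_smul, h2, this]
      simp [TensorProduct.smul_tmul']
  · induction t using TensorProduct.induction_on with
    | zero => simp
    | add x y hx hy => simp only [map_add, hx, hy]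
    | tmul l a =>
      rw [hψ, map_smul, h1, AlgEquiv.apply_symm_apply]
      simp [TensorProduct.smul_tmul']

/-- The orbit map `Γ_L ≃ P_L`, `γ ↦ σ γ`, of a point of a torsor, on coordinate rings. -/
noncomputable def orbitEquiv (P : GroupTorsor K A) (σ : P →ₐ[K] L) : L ⊗[K] P ≃ₐ[L] L ⊗[K] A :=
  AlgEquiv.ofBijective _ (P.orbitBaseChange_bijective σ)

@[simp]
theorem orbitEquiv_tmul (P : GroupTorsor K A) (σ : P →ₐ[K] L) (l : L) (b : P) :
    P.orbitEquiv σ (l ⊗ₜ b) = l • P.orbitMap σ b :=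
  orbitBaseChange_tmul _ _ _ _

@[simp]
theorem trivialization_mk (P : GroupTorsor K A) (σ : P →ₐ[K] L) (l : L) (b : P) :
    P.trivialization σ (PullbackDiff.mk σ l b) = l • P.orbitD σ b :=
  PullbackDiff.lift_mk σ _ _ l b

/-- The orbit map `γ ↦ σ γ` sends the unit section to `σ`. -/
theorem counit_orbitMap (P : GroupTorsor K A) (σ : P →ₐ[K] L) (b : P) :
    Algebra.TensorProduct.rid K L L
      (Algebra.TensorProduct.map (AlgHom.id L L) (Bialgebra.counitAlgHom K A) (P.orbitMap σ b)) =
        σ b := by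
  have h (x : P ⊗[K] A) : Algebra.TensorProduct.rid K L L
      (Algebra.TensorProduct.map (AlgHom.id L L) (Bialgebra.counitAlgHom K A)
        (Algebra.TensorProduct.map σ (AlgHom.id K A) x)) =
      σ ((Algebra.TensorProduct.rid K K P).toAlgHom.comp
        (Algebra.TensorProduct.map (AlgHom.id K P) (Bialgebra.counitAlgHom K A)) x) := by
    induction x using TensorProduct.induction_on with
    | zero => simp
    | add x y hx hy => simp only [map_add, hx, hy]
    | tmul x a => simp
  exact (h _).trans (congrArg σ (DFunLike.congr_fun P.coaction_counit b))

/-- The trivialization is the differential of the isomorphism `orbitEquiv` at the unit section. Its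
inverse is induced by the derivation `a ↦ d(θ⁻¹(1 ⊗ a))`, where `θ = orbitEquiv`. -/
theorem trivialization_bijective (P : GroupTorsor K A) (σ : P →ₐ[K] L) :
    Function.Bijective (P.trivialization σ) := by
  let : Module K (PullbackDiff σ) := Module.compHom _ (algebraMap K L)
  have : IsScalarTower K L (PullbackDiff σ) := IsScalarTower.of_algebraMap_smul fun _ _ => rfl
  let θ := P.orbitEquiv σ
  have hev (x : L ⊗[K] P) :
      Algebra.TensorProduct.lift (AlgHom.id L L) σ (fun _ _ => Commute.all _ _) x =
        Algebra.TensorProduct.rid K L L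
          (Algebra.TensorProduct.map (AlgHom.id L L) (Bialgebra.counitAlgHom K A) (θ x)) := by
    induction x using TensorProduct.induction_on with
    | zero => simp
    | add x y hx hy => simp only [map_add, hx, hy]
    | tmul l b =>
      rw [orbitEquiv_tmul, map_smul, map_smul, counit_orbitMap]
      simp
  let δ : A →ₗ[K] PullbackDiff σ := ((PullbackDiff.ofTensor σ ∘ₗ
    θ.symm.toLinearMap).restrictScalars K) ∘ₗ (TensorProduct.mk K L A 1)
  have hδ (a : A) : δ a = PullbackDiff.ofTensor σ (θ.symm (1 ⊗ₜ a)) := rfl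
  have hδ_mul (a b : A) : δ (a * b) = Bialgebra.counitAlgHom K A a • δ b +
      Bialgebra.counitAlgHom K A b • δ a := by
    have hab : (1 : L) ⊗ₜ[K] (a * b) = 1 ⊗ₜ a * 1 ⊗ₜ b := by simp
    rw [hδ, hab, map_mul, PullbackDiff.ofTensor_mul, hev, hev]
    simp [hδ]
  let ψ : L ⊗[K] CoLie K A →ₗ[L] PullbackDiff σ := LinearMap.liftBaseChange L
    (PullbackDiff.lift (Bialgebra.counitAlgHom K A) δ hδ_mul)
  have hψ (x : L ⊗[K] A) : ψ (LinearMap.lTensor L (CoLie.d K A) x) =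
      PullbackDiff.ofTensor σ (θ.symm x) := by
    induction x using TensorProduct.induction_on with
    | zero => simp
    | add x y hx hy => simp only [map_add, hx, hy]
    | tmul l a =>
      have hla : l ⊗ₜ[K] a = l • (1 ⊗ₜ a) := by rw [TensorProduct.smul_tmul', smul_eq_mul, mul_one]
      have ha : PullbackDiff.lift (Bialgebra.counitAlgHom K A) δ hδ_mul (CoLie.d K A a) = δ a :=
        (PullbackDiff.lift_mk _ _ _ _ _).trans (one_smul _ _)
      rw [LinearMap.lTensor_tmul, LinearMap.liftBaseChange_tmul, ha, hδ, hla, map_smul,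
        map_smul]
  have hd (x : L ⊗[K] P) : P.trivialization σ (PullbackDiff.ofTensor σ x) =
      LinearMap.lTensor L (CoLie.d K A) (θ x) := by
    induction x using TensorProduct.induction_on with
    | zero => simp
    | add x y hx hy => simp only [map_add, hx, hy]
    | tmul l b =>
      have h : LinearMap.lTensor L (CoLie.d K A) (l • P.orbitMap σ b) = l • P.orbitD σ b :=
        map_smul (TensorProduct.AlgebraTensorModule.lTensor L L (CoLie.d K A)) l _
      rw [orbitEquiv_tmul, h, PullbackDiff.ofTensor_tmul, trivialization_mk]
  refine Function.bijective_iff_has_inverse.mpr ⟨ψ, fun w => ?_, fun w => ?_⟩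
  · refine LinearMap.congr_fun (PullbackDiff.linearMap_ext σ
      (f := ψ ∘ₗ P.trivialization σ) (g := LinearMap.id) fun b => ?_) w
    have hb : P.orbitD σ b = LinearMap.lTensor L (CoLie.d K A) (θ (1 ⊗ₜ b)) := by
      rw [orbitEquiv_tmul, one_smul]; rfl
    rw [LinearMap.comp_apply, trivialization_mk, one_smul, hb, hψ, AlgEquiv.symm_apply_apply,
      PullbackDiff.ofTensor_tmul, LinearMap.id_apply]
  · induction w using TensorProduct.induction_on with
    | zero => simp
    | add x y hx hy => simp only [map_add, hx, hy]
    | tmul l v =>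
      have hv : v ∈ Submodule.span K (Set.range (CoLie.d K A)) := by
        rw [show Submodule.span K (Set.range (CoLie.d K A)) = ⊤ from
          PullbackDiff.span_range_mk_one _]
        trivial
      induction hv using Submodule.span_induction generalizing l with
      | mem v hv =>
        obtain ⟨a, rfl⟩ := hv
        rw [← LinearMap.lTensor_tmul, hψ, hd, AlgEquiv.apply_symm_apply]
      | zero => simp
      | add v w _ _ hv hw => simp only [TensorProduct.tmul_add, map_add, hv l, hw l]
      | smul k v _ hv => rw [← TensorProduct.smul_tmul, hv]

/-- The morphism `σ^* Ω_{P/K} → Ω_{L/K}` induced by `σ`, transported to `L ⊗ ω_Γ` by the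
trivialization. -/
noncomputable def differential (P : GroupTorsor K A) (σ : P →ₐ[K] L) :
    L ⊗[K] CoLie K A →ₗ[L] Ω[L⁄K] :=
  PullbackDiff.toDiff σ ∘ₗ
    (LinearEquiv.ofBijective (P.trivialization σ) (P.trivialization_bijective σ)).symm.toLinearMap

theorem differential_trivialization (P : GroupTorsor K A) (σ : P →ₐ[K] L) (w : PullbackDiff σ) :
    P.differential σ (P.trivialization σ w) = PullbackDiff.toDiff σ w :=
  congrArg (PullbackDiff.toDiff σ) ((LinearEquiv.ofBijective (P.trivialization σ)
    (P.trivialization_bijective σ)).symm_apply_apply w)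

theorem differential_orbitD (P : GroupTorsor K A) (σ : P →ₐ[K] L) (b : P) :
    P.differential σ (P.orbitD σ b) = KaehlerDifferential.D K L (σ b) := by
  have h := P.differential_trivialization σ (PullbackDiff.mk σ 1 b)
  rwa [trivialization_mk, PullbackDiff.toDiff_mk, one_smul, one_smul] at h

theorem eq_differential (P : GroupTorsor K A) (σ : P →ₐ[K] L)
    {f : L ⊗[K] CoLie K A →ₗ[L] Ω[L⁄K]}
    (hf : ∀ b, f (P.orbitD σ b) = KaehlerDifferential.D K L (σ b)) : f = P.differential σ := by
  refine LinearMap.ext fun v => ?_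
  obtain ⟨w, rfl⟩ := (P.trivialization_bijective σ).2 v
  refine LinearMap.congr_fun (PullbackDiff.linearMap_ext σ
    (f := f ∘ₗ P.trivialization σ) (g := P.differential σ ∘ₗ P.trivialization σ) fun b => ?_) w
  simp only [LinearMap.comp_apply, trivialization_mk, one_smul, hf, differential_orbitD]

end

end GroupTorsor

/-! ### Horizontal elements of a connection -/

section Descent

variable {K L M : Type*} [Field K] [CommRing L] [Algebra K L] [AddCommGroup M]
  [Module K M] [Module L M] [IsScalarTower K L M]

/-- The Leibniz rule `(d ⊗ 1)(l y) = dl ⊗ y + l (d ⊗ 1)(y)`, where `dl ⊗ y ∈ M ⊗[L] (L ⊗[K] A)` is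
viewed in `M ⊗[K] A`. -/
theorem Derivation.rTensor_smul {A : Type*} [AddCommGroup A] [Module K A] (d : Derivation K L M)
    (l : L) (y : L ⊗[K] A) : LinearMap.rTensor A (d : L →ₗ[K] M) (l • y) =
      TensorProduct.AlgebraTensorModule.cancelBaseChange K L L M A (d l ⊗ₜ y) +
        l • LinearMap.rTensor A (d : L →ₗ[K] M) y := by
  induction y using TensorProduct.induction_on with
  | zero => simp
  | add x y hx hy => simp only [smul_add, map_add, TensorProduct.tmul_add, hx, hy]; abel
  | tmul m a =>
    simp [TensorProduct.smul_tmul', TensorProduct.add_tmul, add_comm]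

/-- The base change `M ⊗ B ≃ M ⊗ A` to an `L`-module `M` of an `L`-linear equivalence
`L ⊗ B ≃ L ⊗ A`. -/
noncomputable def LinearEquiv.tensorBaseChange (M : Type*) [AddCommGroup M]
    [Module K M] [Module L M] [IsScalarTower K L M] {A B : Type*} [AddCommGroup A] [Module K A]
    [AddCommGroup B] [Module K B] (θ : L ⊗[K] B ≃ₗ[L] L ⊗[K] A) : M ⊗[K] B ≃ₗ[L] M ⊗[K] A :=
  (TensorProduct.AlgebraTensorModule.cancelBaseChange K L L M B).symm ≪≫ₗ
    TensorProduct.congr (LinearEquiv.refl L M) θ ≪≫ₗ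
    TensorProduct.AlgebraTensorModule.cancelBaseChange K L L M A

theorem LinearEquiv.tensorBaseChange_tmul {A B : Type*} [AddCommGroup A] [Module K A]
    [AddCommGroup B] [Module K B] (θ : L ⊗[K] B ≃ₗ[L] L ⊗[K] A) (m : M) (b : B) :
    θ.tensorBaseChange M (m ⊗ₜ b) =
      TensorProduct.AlgebraTensorModule.cancelBaseChange K L L M A (m ⊗ₜ θ (1 ⊗ₜ b)) := by
  simp [LinearEquiv.tensorBaseChange]

/-- Let `d : L → M` have constants `K` and let `E` be `L`-linear, so that `d ⊗ 1 - E` is a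
connection on `L ⊗ A`. If `L ⊗ A` has a `K`-form `B` consisting of horizontal elements, then every
horizontal element lies in `B`: under `L ⊗ A ≃ L ⊗ B` the connection becomes `d ⊗ 1`, whose kernel
is `B` since `K → L → M` is exact and `B` is flat. -/
theorem exists_tmul_eq_of_rTensor_eq {A B : Type*} [AddCommGroup A] [Module K A]
    [AddCommGroup B] [Module K B] (d : Derivation K L M)
    (hd : ∀ x, d x = 0 → x ∈ Set.range (algebraMap K L))
    (θ : L ⊗[K] B ≃ₗ[L] L ⊗[K] A) (E : L ⊗[K] A →ₗ[L] M ⊗[K] A)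
    (hE : ∀ b, LinearMap.rTensor A (d : L →ₗ[K] M) (θ (1 ⊗ₜ b)) = E (θ (1 ⊗ₜ b)))
    {y : L ⊗[K] A} (hy : LinearMap.rTensor A (d : L →ₗ[K] M) y = E y) :
    ∃ b, θ (1 ⊗ₜ b) = y := by
  have hθM (z : L ⊗[K] B) : LinearMap.rTensor A (d : L →ₗ[K] M) (θ z) =
      θ.tensorBaseChange M (LinearMap.rTensor B (d : L →ₗ[K] M) z) + E (θ z) := by
    induction z using TensorProduct.induction_on with
    | zero => simp
    | add x y hx hy => simp only [map_add, hx, hy]; abel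
    | tmul l b =>
      have hlb : l ⊗ₜ[K] b = l • (1 ⊗ₜ b) := by rw [TensorProduct.smul_tmul', smul_eq_mul, mul_one]
      have h : LinearMap.rTensor B (d : L →ₗ[K] M) (l ⊗ₜ b) = d l ⊗ₜ b := rfl
      rw [h, hlb, map_smul, Derivation.rTensor_smul, hE, map_smul]
      rw [LinearEquiv.tensorBaseChange_tmul]
  obtain ⟨z, rfl⟩ := θ.surjective y
  have hz : LinearMap.rTensor B (d : L →ₗ[K] M) z = 0 := by
    rw [hθM, add_eq_right] at hy
    exact (θ.tensorBaseChange M).map_eq_zero_iff.mp hy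
  have hex : Function.Exact (Algebra.linearMap K L) (d : L →ₗ[K] M) := fun x =>
    ⟨hd x, by rintro ⟨k, rfl⟩; exact d.map_algebraMap k⟩
  obtain ⟨w, rfl⟩ := (Module.Flat.rTensor_exact B hex z).mp hz
  obtain ⟨b, rfl⟩ := (TensorProduct.lid K B).symm.surjective w
  exact ⟨b, by simp⟩

end Descent

/-! ### A torsor is determined by its differential -/

theorem Algebra.TensorProduct.map_comp_id_apply {K A B C D : Type*} [CommRing K] [CommRing A]
    [Algebra K A] [CommRing B] [Algebra K B] [CommRing C] [Algebra K C] [CommRing D] [Algebra K D]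
    (g : C →ₐ[K] D) (f : B →ₐ[K] C) (t : B ⊗[K] A) :
    Algebra.TensorProduct.map (g.comp f) (AlgHom.id K A) t =
      Algebra.TensorProduct.map g (AlgHom.id K A)
        (Algebra.TensorProduct.map f (AlgHom.id K A) t) := by
  rw [← AlgHom.comp_apply, ← Algebra.TensorProduct.map_comp, AlgHom.id_comp]

section Orbit

variable {K A B L : Type*} [Field K] [CommRing A] [HopfAlgebra K A] [CommRing B] [Algebra K B]
  [CommRing L] [Algebra K L]

/-- `(σ γ) γ' = σ (γ γ')`: the orbit map is equivariant. -/
theorem map_orbit_coaction {c : B →ₐ[K] B ⊗[K] A}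
    (hc : (Algebra.TensorProduct.assoc K K K B A A).toAlgHom.comp
        ((Algebra.TensorProduct.map c (AlgHom.id K A)).comp c) =
      (Algebra.TensorProduct.map (AlgHom.id K B) (Bialgebra.comulAlgHom K A)).comp c)
    (σ : B →ₐ[K] L) (b : B) :
    Algebra.TensorProduct.assoc K K K L A A (Algebra.TensorProduct.map
      ((Algebra.TensorProduct.map σ (AlgHom.id K A)).comp c) (AlgHom.id K A) (c b)) =
      Algebra.TensorProduct.map (AlgHom.id K L) (Bialgebra.comulAlgHom K A)
        (Algebra.TensorProduct.map σ (AlgHom.id K A) (c b)) := by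
  have h1 (t : (B ⊗[K] A) ⊗[K] A) : Algebra.TensorProduct.assoc K K K L A A
      (Algebra.TensorProduct.map (Algebra.TensorProduct.map σ (AlgHom.id K A)) (AlgHom.id K A) t) =
      Algebra.TensorProduct.map σ (AlgHom.id K (A ⊗[K] A))
        (Algebra.TensorProduct.assoc K K K B A A t) := by
    refine AlgHom.congr_fun (φ₁ := (Algebra.TensorProduct.assoc K K K L A A).toAlgHom.comp
      (Algebra.TensorProduct.map (Algebra.TensorProduct.map σ (AlgHom.id K A)) (AlgHom.id K A)))
      (φ₂ := (Algebra.TensorProduct.map σ (AlgHom.id K (A ⊗[K] A))).comp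
        (Algebra.TensorProduct.assoc K K K B A A).toAlgHom) ?_ t
    ext <;> simp [Algebra.TensorProduct.one_def]
  have h2 (t : B ⊗[K] A) : Algebra.TensorProduct.map σ (AlgHom.id K (A ⊗[K] A))
      (Algebra.TensorProduct.map (AlgHom.id K B) (Bialgebra.comulAlgHom K A) t) =
      Algebra.TensorProduct.map (AlgHom.id K L) (Bialgebra.comulAlgHom K A)
        (Algebra.TensorProduct.map σ (AlgHom.id K A) t) := by
    induction t using TensorProduct.induction_on with
    | zero => simp
    | add x y hx hy => simp only [map_add, hx, hy]
    | tmul x a => simp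
  have h3 := DFunLike.congr_fun hc b
  simp only [AlgHom.comp_apply] at h3
  rw [← h2, ← h3, Algebra.TensorProduct.map_comp_id_apply, h1]
  rfl

end Orbit

namespace GroupTorsor

variable {K A : Type u} [Field K] [CommRing A] [HopfAlgebra K A]

variable {L : Type u} [CommRing L] [Algebra K L]

theorem map_orbitMap_coaction (P : GroupTorsor K A) (σ : P →ₐ[K] L) (b : P) :
    Algebra.TensorProduct.assoc K K K L A A
      (Algebra.TensorProduct.map (P.orbitMap σ) (AlgHom.id K A) (P.coaction b)) =
      Algebra.TensorProduct.map (AlgHom.id K L) (Bialgebra.comulAlgHom K A) (P.orbitMap σ b) :=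
  map_orbit_coaction P.coaction_coassoc σ b

/-- The `L`-linear map `L ⊗ A → Ω_{L/K} ⊗ A` obtained from `ξ : L ⊗ ω_Γ → Ω_{L/K}`: with
`Δ a = ∑ a₁ ⊗ a₂` it sends `l ⊗ a` to `∑ ξ(l ⊗ d a₁) ⊗ a₂`. -/
noncomputable def connection (ξ : L ⊗[K] CoLie K A →ₗ[L] Ω[L⁄K]) : L ⊗[K] A →ₗ[L] Ω[L⁄K] ⊗[K] A :=
  TensorProduct.AlgebraTensorModule.map
      (ξ ∘ₗ TensorProduct.AlgebraTensorModule.lTensor L L (CoLie.d K A)) LinearMap.id ∘ₗ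
    (TensorProduct.AlgebraTensorModule.assoc K K L L A A).symm.toLinearMap ∘ₗ
    TensorProduct.AlgebraTensorModule.lTensor L L Coalgebra.comul

/-- The functions on `Γ_L` coming from `P` are horizontal: by equivariance of the orbit map, the
identity `ξ(orbitD σ b) = d(σ b)` propagates from the unit section to all of `Γ_L`. -/
theorem rTensor_D_orbitMap (P : GroupTorsor K A) (σ : P →ₐ[K] L) (b : P) :
    LinearMap.rTensor A (KaehlerDifferential.D K L : L →ₗ[K] Ω[L⁄K]) (P.orbitMap σ b) =
      connection (P.differential σ) (P.orbitMap σ b) := by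
  have h1 (t : P ⊗[K] A) : LinearMap.rTensor A (KaehlerDifferential.D K L : L →ₗ[K] Ω[L⁄K])
      (Algebra.TensorProduct.map σ (AlgHom.id K A) t) =
      TensorProduct.AlgebraTensorModule.map
      (P.differential σ ∘ₗ TensorProduct.AlgebraTensorModule.lTensor L L (CoLie.d K A))
        LinearMap.id (Algebra.TensorProduct.map (P.orbitMap σ) (AlgHom.id K A) t) := by
    induction t using TensorProduct.induction_on with
    | zero => simp
    | add x y hx hy => simp only [map_add, hx, hy]
    | tmul x a =>
      exact congrArg (· ⊗ₜ[K] a) (P.differential_orbitD σ x).symm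
  refine (h1 _).trans (congrArg (TensorProduct.AlgebraTensorModule.map _ _) ?_)
  refine ((TensorProduct.AlgebraTensorModule.assoc K K L L A A).symm_apply_eq.mpr ?_).symm
  exact (P.map_orbitMap_coaction σ b).symm

theorem orbitMap_injective [Nontrivial L] (P : GroupTorsor K A) (σ : P →ₐ[K] L) :
    Function.Injective (P.orbitMap σ) := by
  have h : ⇑(P.orbitMap σ) = P.orbitEquiv σ ∘ Algebra.TensorProduct.includeRight (R := K) := by
    ext b
    simp
  rw [h]
  exact (P.orbitEquiv σ).injective.comp
    (Algebra.TensorProduct.includeRight_injective (algebraMap K L).injective)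

theorem mem_range_orbitMap_iff
    (hD : ∀ x, KaehlerDifferential.D K L x = 0 → x ∈ Set.range (algebraMap K L))
    (P : GroupTorsor K A) (σ : P →ₐ[K] L) (y : L ⊗[K] A) : y ∈ Set.range (P.orbitMap σ) ↔
      LinearMap.rTensor A (KaehlerDifferential.D K L : L →ₗ[K] Ω[L⁄K]) y =
        connection (P.differential σ) y := by
  constructor
  · rintro ⟨b, rfl⟩
    exact P.rTensor_D_orbitMap σ b
  · intro hy
    have h (b : P) : (P.orbitEquiv σ).toLinearEquiv (1 ⊗ₜ b) = P.orbitMap σ b := by simp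
    obtain ⟨b, hb⟩ := exists_tmul_eq_of_rTensor_eq (KaehlerDifferential.D K L) hD
      (P.orbitEquiv σ).toLinearEquiv _ (fun b => by rw [h]; exact P.rTensor_D_orbitMap σ b) hy
    exact ⟨b, by rw [← h, hb]⟩

/-- Both torsors have the same image in `L ⊗ A` under the orbit maps, which are equivariant. -/
theorem iso_of_differential_eq [Nontrivial L]
    (hD : ∀ x, KaehlerDifferential.D K L x = 0 → x ∈ Set.range (algebraMap K L))
    {P Q : GroupTorsor K A} (σ : P →ₐ[K] L) (τ : Q →ₐ[K] L)
    (h : P.differential σ = Q.differential τ) : P.Iso Q := by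
  have hrange : (P.orbitMap σ).range = (Q.orbitMap τ).range := by
    refine SetLike.ext fun y => ?_
    have := (P.mem_range_orbitMap_iff hD σ y).trans (h ▸ (Q.mem_range_orbitMap_iff hD τ y).symm)
    exact this
  let e : P ≃ₐ[K] Q := (AlgEquiv.ofInjective _ (P.orbitMap_injective σ)).trans
    ((Subalgebra.equivOfEq _ _ hrange).trans
      (AlgEquiv.ofInjective _ (Q.orbitMap_injective τ)).symm)
  have he (b : P) : Q.orbitMap τ (e b) = P.orbitMap σ b := by
    have := (AlgEquiv.ofInjective _ (Q.orbitMap_injective τ)).apply_symm_apply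
      (Subalgebra.equivOfEq _ _ hrange (AlgEquiv.ofInjective _ (P.orbitMap_injective σ) b))
    exact congrArg Subtype.val this
  refine ⟨e, AlgHom.ext fun b => ?_⟩
  have hinj : Function.Injective (Algebra.TensorProduct.map (Q.orbitMap τ) (AlgHom.id K A)) :=
    Module.Flat.rTensor_preserves_injective_linearMap (M := A) (Q.orbitMap τ).toLinearMap
      (Q.orbitMap_injective τ)
  refine hinj ((Algebra.TensorProduct.assoc K K K L A A).injective ?_)
  have hcomp (t : P ⊗[K] A) : Algebra.TensorProduct.map (Q.orbitMap τ) (AlgHom.id K A)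
      (Algebra.TensorProduct.map e.toAlgHom (AlgHom.id K A) t) =
      Algebra.TensorProduct.map (P.orbitMap σ) (AlgHom.id K A) t := by
    induction t using TensorProduct.induction_on with
    | zero => simp
    | add x y hx hy => simp only [map_add, hx, hy]
    | tmul x a => simp [he]
  have h1 := Q.map_orbitMap_coaction τ (e b)
  rw [he, ← P.map_orbitMap_coaction σ b, ← hcomp] at h1
  exact h1

theorem differential_eq_of_iso {P Q : GroupTorsor K A} (σ : P →ₐ[K] L) (τ : Q →ₐ[K] L)
    {e : P ≃ₐ[K] Q} (he : Q.coaction.comp e.toAlgHom =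
    (Algebra.TensorProduct.map e.toAlgHom (AlgHom.id K A)).comp P.coaction)
    (h : τ.comp e.toAlgHom = σ) : P.differential σ = Q.differential τ := by
  symm
  refine P.eq_differential σ fun b => ?_
  have horb : P.orbitMap σ b = Q.orbitMap τ (e b) := by
    have h1 := DFunLike.congr_fun he b
    simp only [AlgHom.comp_apply] at h1
    rw [orbitMap_apply, orbitMap_apply, ← h, Algebra.TensorProduct.map_comp_id_apply, ← h1]
    rfl
  have horbD : P.orbitD σ b = Q.orbitD τ (e b) := congrArg _ horb
  rw [horbD, differential_orbitD, ← h]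
  rfl

/-! ### Additivity of the differential under contracted products -/

theorem actSnd_tmul (P P' : GroupTorsor K A) (b : P) (b' : P') :
    actSnd P P' (b ⊗ₜ b') = (Algebra.TensorProduct.assoc K K K P P' A).symm
      (b ⊗ₜ P'.coaction b') := rfl

theorem actFst_tmul (P P' : GroupTorsor K A) (b : P) (b' : P') :
    actFst P P' (b ⊗ₜ b') = Algebra.TensorProduct.map (Algebra.TensorProduct.comm K P' P).toAlgHom
      (AlgHom.id K A) ((Algebra.TensorProduct.assoc K K K P' P A).symm (b' ⊗ₜ P.coaction b)) := rfl

/-- The point `(σ, σ')` of `P × P'`. -/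
noncomputable def prodPoint {P P' : GroupTorsor K A} (σ : P →ₐ[K] L) (σ' : P' →ₐ[K] L) :
    P ⊗[K] P' →ₐ[K] L := Algebra.TensorProduct.lift σ σ' (fun _ _ => Commute.all _ _)

@[simp]
theorem prodPoint_tmul {P P' : GroupTorsor K A} (σ : P →ₐ[K] L) (σ' : P' →ₐ[K] L)
    (b : P) (b' : P') : prodPoint σ σ' (b ⊗ₜ b') = σ b * σ' b' := rfl

theorem map_prodPoint_actSnd {P P' : GroupTorsor K A} (σ : P →ₐ[K] L) (σ' : P' →ₐ[K] L)
    (b : P) (b' : P') : Algebra.TensorProduct.map (prodPoint σ σ') (AlgHom.id K A)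
      (actSnd P P' (b ⊗ₜ b')) = σ b • P'.orbitMap σ' b' := by
  rw [actSnd_tmul, orbitMap_apply]
  induction P'.coaction b' using TensorProduct.induction_on with
  | zero => simp
  | add x y hx hy => simp only [map_add, TensorProduct.tmul_add, smul_add, hx, hy]
  | tmul x a => simp [TensorProduct.smul_tmul']

theorem map_prodPoint_actFst {P P' : GroupTorsor K A} (σ : P →ₐ[K] L) (σ' : P' →ₐ[K] L)
    (b : P) (b' : P') : Algebra.TensorProduct.map (prodPoint σ σ') (AlgHom.id K A)
      (actFst P P' (b ⊗ₜ b')) = σ' b' • P.orbitMap σ b := by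
  rw [actFst_tmul, orbitMap_apply]
  induction P.coaction b using TensorProduct.induction_on with
  | zero => simp
  | add x y hx hy => simp only [map_add, TensorProduct.tmul_add, smul_add, hx, hy]
  | tmul x a => simp [TensorProduct.smul_tmul', mul_comm]

/-- For `u = b ⊗ b'`, the Leibniz rule expresses `d((σ, σ')(u))` through the derivatives of `u`
along the actions of `Γ` on the first and on the second factor; for an invariant `u` these two
derivatives coincide. -/
theorem differential_of_isSum {P P' Q : GroupTorsor K A} {q : Q →ₐ[K] P ⊗[K] P'}
    (hinv : ∀ t, actFst P P' (q t) = actSnd P P' (q t))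
    (hq : (actFst P P').comp q = (Algebra.TensorProduct.map q (AlgHom.id K A)).comp Q.coaction)
    (σ : P →ₐ[K] L) (σ' : P' →ₐ[K] L) :
    Q.differential ((prodPoint σ σ').comp q) = P.differential σ + P'.differential σ' := by
  symm
  refine Q.eq_differential _ fun t => ?_
  let δ := TensorProduct.AlgebraTensorModule.lTensor L L (CoLie.d K A)
  let m := Algebra.TensorProduct.map (prodPoint σ σ') (AlgHom.id K A)
  have horb : Q.orbitD ((prodPoint σ σ').comp q) t = δ (m (actFst P P' (q t))) := by
    have h := DFunLike.congr_fun hq t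
    simp only [AlgHom.comp_apply] at h
    change δ (Q.orbitMap _ t) = _
    rw [h, orbitMap_apply, Algebra.TensorProduct.map_comp_id_apply]
  have hD (u : P ⊗[K] P') : KaehlerDifferential.D K L (prodPoint σ σ' u) =
      P.differential σ (δ (m (actFst P P' u))) + P'.differential σ' (δ (m (actSnd P P' u))) := by
    induction u using TensorProduct.induction_on with
    | zero => simp
    | add x y hx hy => simp only [map_add, hx, hy]; abel
    | tmul b b' =>
      have h1 : P.differential σ (δ (P.orbitMap σ b)) = _ := P.differential_orbitD σ b
      have h2 : P'.differential σ' (δ (P'.orbitMap σ' b')) = _ := P'.differential_orbitD σ' b'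
      rw [map_prodPoint_actFst, map_prodPoint_actSnd, map_smul, map_smul, map_smul, map_smul, h1,
        h2, prodPoint_tmul, Derivation.leibniz, add_comm]
  rw [horb, LinearMap.add_apply, AlgHom.comp_apply, hD, ← hinv]

end GroupTorsor

/-! ### The trivial torsor -/

section Trivial

variable {K A : Type*} [Field K] [CommRing A] [HopfAlgebra K A]

/-- The map `a ⊗ b ↦ (a ⊗ 1) * (f ⊗ 1)(Δ b)`: for `f = id` it is dual to `(γ, γ') ↦ (γ, γ γ')`, and
for `f` the antipode to `(γ, γ') ↦ (γ, γ⁻¹ γ')`. -/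
noncomputable def HopfAlgebra.shearOf (f : A →ₗ[K] A) : A ⊗[K] A →ₗ[K] A ⊗[K] A :=
  LinearMap.rTensor A (LinearMap.mul' K A ∘ₗ LinearMap.lTensor A f) ∘ₗ
    (TensorProduct.assoc K A A A).symm.toLinearMap ∘ₗ LinearMap.lTensor A Coalgebra.comul

theorem HopfAlgebra.shearOf_tmul (f : A →ₗ[K] A) (a b : A) :
    HopfAlgebra.shearOf f (a ⊗ₜ b) = a ⊗ₜ 1 * LinearMap.rTensor A f (Coalgebra.comul b) := by
  simp only [shearOf, LinearMap.comp_apply, LinearMap.lTensor_tmul]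
  induction Coalgebra.comul (R := K) b using TensorProduct.induction_on with
  | zero => simp
  | add x y hx hy => simp only [map_add, TensorProduct.tmul_add, mul_add, hx, hy]
  | tmul x y => simp

/-- The composite of two such maps is the one of the convolution product `g * f`. -/
theorem HopfAlgebra.shearOf_comp_shearOf (f g : A →ₗ[K] A) (a b : A) :
    HopfAlgebra.shearOf f (HopfAlgebra.shearOf g (a ⊗ₜ b)) =
      a ⊗ₜ 1 * LinearMap.rTensor A (LinearMap.mul' K A ∘ₗ TensorProduct.map g f ∘ₗ Coalgebra.comul)
        (Coalgebra.comul b) := by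
  have h1 (t : A ⊗[K] A) : shearOf f (a ⊗ₜ 1 * LinearMap.rTensor A g t) =
      a ⊗ₜ 1 * LinearMap.rTensor A (LinearMap.mul' K A ∘ₗ TensorProduct.map g f)
        ((TensorProduct.assoc K A A A).symm (LinearMap.lTensor A Coalgebra.comul t)) := by
    induction t using TensorProduct.induction_on with
    | zero => simp
    | add x y hx hy => simp only [map_add, mul_add, hx, hy]
    | tmul x y =>
      simp only [LinearMap.rTensor_tmul, LinearMap.lTensor_tmul,
        Algebra.TensorProduct.tmul_mul_tmul, one_mul, shearOf_tmul]
      induction Coalgebra.comul (R := K) y using TensorProduct.induction_on with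
      | zero => simp
      | add x y hx hy => simp only [map_add, TensorProduct.tmul_add, mul_add, hx, hy]
      | tmul z y => simp [mul_assoc]
  rw [shearOf_tmul, h1, Coalgebra.coassoc_symm_apply, ← LinearMap.comp_assoc,
    LinearMap.rTensor_comp_apply _ _ Coalgebra.comul]

theorem HopfAlgebra.shearOf_comp_eq_id {f g : A →ₗ[K] A}
    (h : LinearMap.mul' K A ∘ₗ TensorProduct.map g f ∘ₗ Coalgebra.comul =
      Algebra.linearMap K A ∘ₗ Coalgebra.counit) (t : A ⊗[K] A) :
    HopfAlgebra.shearOf f (HopfAlgebra.shearOf g t) = t := by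
  induction t using TensorProduct.induction_on with
  | zero => simp
  | add x y hx hy => simp only [map_add, hx, hy]
  | tmul a b =>
    rw [shearOf_comp_shearOf, h, LinearMap.rTensor_comp_apply, Coalgebra.rTensor_counit_comul]
    simp

variable (K A) in
theorem HopfAlgebra.bijective_shear : Function.Bijective
    (Algebra.TensorProduct.lift (Algebra.TensorProduct.includeLeft : A →ₐ[K] A ⊗[K] A)
      (Bialgebra.comulAlgHom K A) (fun _ _ => Commute.all _ _)) := by
  have h : ⇑(Algebra.TensorProduct.lift (Algebra.TensorProduct.includeLeft : A →ₐ[K] A ⊗[K] A)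
      (Bialgebra.comulAlgHom K A) (fun _ _ => Commute.all _ _)) =
      HopfAlgebra.shearOf (LinearMap.id (R := K) (M := A)) := by
    funext t
    induction t using TensorProduct.induction_on with
    | zero => simp
    | add x y hx hy => simp only [map_add, hx, hy]
    | tmul a b => simp [shearOf_tmul]
  rw [h]
  exact Function.bijective_iff_has_inverse.mpr ⟨shearOf (HopfAlgebra.antipode K),
    shearOf_comp_eq_id HopfAlgebra.mul_antipode_lTensor_comul,
    shearOf_comp_eq_id HopfAlgebra.mul_antipode_rTensor_comul⟩

end Trivial

/-- `Γ` as a torsor under itself. -/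
noncomputable def GroupTorsor.trivialTorsor (K A : Type u) [Field K] [CommRing A]
    [HopfAlgebra K A] : GroupTorsor K A where
  carrier := A
  nontrivial := Bialgebra.nontrivial (R := K)
  coaction := Bialgebra.comulAlgHom K A
  coaction_coassoc := AlgHom.ext fun a => Coalgebra.coassoc_apply a
  coaction_counit := AlgHom.ext fun a =>
    (congrArg (TensorProduct.rid K A) (Coalgebra.lTensor_counit_comul a)).trans (by simp)
  bijective_shear := HopfAlgebra.bijective_shear K A

/-! ### A criterion for torsors -/

section Orbit

variable {K A B L : Type*} [Field K] [CommRing A] [HopfAlgebra K A] [CommRing B] [Algebra K B]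
  [CommRing L] [Algebra K L]

variable (K A L) in
/-- The base change to `L` of the shear isomorphism of `A`, with its effect on the two factors. -/
theorem HopfAlgebra.exists_lTensor_shear : ∃ T : (L ⊗[K] A) ⊗[K] A →ₐ[K] (L ⊗[K] A) ⊗[K] A,
    Function.Bijective T ∧ (∀ x : L ⊗[K] A, T (x ⊗ₜ 1) = x ⊗ₜ 1) ∧
    ∀ y : L ⊗[K] A, T (Algebra.TensorProduct.map
      (Algebra.TensorProduct.includeLeft : L →ₐ[K] L ⊗[K] A) (AlgHom.id K A) y) =
        (Algebra.TensorProduct.assoc K K K L A A).symm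
          (Algebra.TensorProduct.map (AlgHom.id K L) (Bialgebra.comulAlgHom K A) y) := by
  let S := Algebra.TensorProduct.lift (Algebra.TensorProduct.includeLeft : A →ₐ[K] A ⊗[K] A)
    (Bialgebra.comulAlgHom K A) (fun _ _ => Commute.all _ _)
  refine ⟨(Algebra.TensorProduct.assoc K K K L A A).symm.toAlgHom.comp
      ((Algebra.TensorProduct.map (AlgHom.id K L) S).comp
        (Algebra.TensorProduct.assoc K K K L A A).toAlgHom), ?_, fun x => ?_, fun y => ?_⟩
  · have h1 : Function.Bijective (LinearMap.lTensor L S.toLinearMap) :=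
      (TensorProduct.congr (LinearEquiv.refl K L) (LinearEquiv.ofBijective S.toLinearMap
        (HopfAlgebra.bijective_shear K A))).bijective
    exact (Algebra.TensorProduct.assoc K K K L A A).symm.bijective.comp
      (h1.comp (Algebra.TensorProduct.assoc K K K L A A).bijective)
  · induction x using TensorProduct.induction_on with
    | zero => simp
    | add x y hx hy => simp only [TensorProduct.add_tmul, map_add, hx, hy]
    | tmul l a => simp [S]
  · induction y using TensorProduct.induction_on with
    | zero => simp
    | add x y hx hy => simp only [map_add, hx, hy]
    | tmul l a => simp [S, ← Algebra.TensorProduct.one_def]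

/-- A scheme with an action of `Γ` and an `L`-valued point `σ` whose orbit map `Γ_L → (Spec B)_L` is
an isomorphism is a torsor. It suffices to test this over `L`. Using `(x, γ) ↦ (x, x γ)` with
`x = σ γ'` and the identity `(σ γ') γ = σ (γ' γ)`, the shear map over `L` becomes a composite of the
orbit map and of the shear map of `Γ`. -/
theorem bijective_shear_of_orbitBaseChange [Nontrivial L] {c : B →ₐ[K] B ⊗[K] A}
    (hc : (Algebra.TensorProduct.assoc K K K B A A).toAlgHom.comp
        ((Algebra.TensorProduct.map c (AlgHom.id K A)).comp c) =
      (Algebra.TensorProduct.map (AlgHom.id K B) (Bialgebra.comulAlgHom K A)).comp c)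
    (σ : B →ₐ[K] L) (hσ : Function.Bijective (orbitBaseChange c σ)) :
    Function.Bijective (Algebra.TensorProduct.lift
      (Algebra.TensorProduct.includeLeft : B →ₐ[K] B ⊗[K] A) c (fun _ _ => Commute.all _ _)) := by
  obtain ⟨θ, hθ⟩ : ∃ θ : L ⊗[K] B ≃ₗ[L] L ⊗[K] A, ∀ l b, θ (l ⊗ₜ b) =
      l • Algebra.TensorProduct.map σ (AlgHom.id K A) (c b) :=
    ⟨LinearEquiv.ofBijective (orbitBaseChange c σ).toLinearMap hσ, orbitBaseChange_tmul c σ⟩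
  obtain ⟨T, hT, hT_left, hTmap⟩ := HopfAlgebra.exists_lTensor_shear K A L
  -- `Ψ` is the orbit map isomorphism, base changed from `L` to `L ⊗ A`.
  obtain ⟨Ψ, hΨ⟩ : ∃ Ψ : (L ⊗[K] A) ⊗[K] B ≃ₗ[K] (L ⊗[K] A) ⊗[K] A, ∀ x b, Ψ (x ⊗ₜ b) =
      x ⊗ₜ 1 * Algebra.TensorProduct.map (Algebra.TensorProduct.includeLeft : L →ₐ[K] L ⊗[K] A)
        (AlgHom.id K A) (θ (1 ⊗ₜ b)) := by
    refine ⟨(θ.tensorBaseChange (L ⊗[K] A)).restrictScalars K, fun x b => ?_⟩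
    rw [LinearEquiv.restrictScalars_apply, LinearEquiv.tensorBaseChange_tmul]
    induction θ (1 ⊗ₜ b) using TensorProduct.induction_on with
    | zero => simp
    | add y z hy hz => simp only [map_add, TensorProduct.tmul_add, mul_add, hy, hz]
    | tmul l a => simp [Algebra.smul_def, mul_comm]
  obtain ⟨S, hS⟩ : ∃ S : B ⊗[K] B →ₗ[K] B ⊗[K] A, S = (Algebra.TensorProduct.lift
      (Algebra.TensorProduct.includeLeft : B →ₐ[K] B ⊗[K] A) c
        (fun _ _ => Commute.all _ _)).toLinearMap := ⟨_, rfl⟩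
  have hS_tmul (b b' : B) : S (b ⊗ₜ b') = b ⊗ₜ 1 * c b' := by rw [hS]; rfl
  let θB : (L ⊗[K] B) ⊗[K] B ≃ₗ[K] (L ⊗[K] A) ⊗[K] B :=
    TensorProduct.congr (θ.restrictScalars K) (LinearEquiv.refl K B)
  let θA : (L ⊗[K] B) ⊗[K] A ≃ₗ[K] (L ⊗[K] A) ⊗[K] A :=
    TensorProduct.congr (θ.restrictScalars K) (LinearEquiv.refl K A)
  have hcomp : θA.toLinearMap ∘ₗ (TensorProduct.assoc K L B A).symm.toLinearMap ∘ₗ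
      LinearMap.lTensor L S = T.toLinearMap ∘ₗ Ψ.toLinearMap ∘ₗ θB.toLinearMap ∘ₗ
        (TensorProduct.assoc K L B B).symm.toLinearMap := by
    refine TensorProduct.ext' fun l w => ?_
    induction w using TensorProduct.induction_on with
    | zero => simp only [TensorProduct.tmul_zero, map_zero]
    | add x y hx hy => simp only [TensorProduct.tmul_add, map_add, hx, hy]
    | tmul b b' =>
      have h1 : θB ((TensorProduct.assoc K L B B).symm (l ⊗ₜ (b ⊗ₜ b'))) = θ (l ⊗ₜ b) ⊗ₜ b' := rfl
      simp only [LinearMap.comp_apply, LinearEquiv.coe_coe, LinearMap.lTensor_tmul, hS_tmul, h1, hΨ,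
        AlgHom.toLinearMap_apply, map_mul T, hT_left, hTmap, hθ 1, one_smul]
      rw [← map_orbit_coaction hc, AlgEquiv.symm_apply_apply]
      induction c b' using TensorProduct.induction_on with
      | zero => simp only [mul_zero, TensorProduct.tmul_zero, map_zero]
      | add x y hx hy => simp only [map_add, TensorProduct.tmul_add, mul_add, hx, hy]
      | tmul x a =>
        have h2 : θA ((TensorProduct.assoc K L B A).symm (l ⊗ₜ (b ⊗ₜ 1 * x ⊗ₜ a))) =
            θ (l ⊗ₜ (b * x)) ⊗ₜ (1 * a) := by
          rw [Algebra.TensorProduct.tmul_mul_tmul]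
          rfl
        rw [h2, Algebra.TensorProduct.map_tmul, Algebra.TensorProduct.tmul_mul_tmul, hθ, hθ,
          map_mul c, map_mul, smul_mul_assoc]
        rfl
  have hbij : Function.Bijective (LinearMap.lTensor L S) := by
    have h1 : Function.Bijective (θA.toLinearMap ∘ₗ
        (TensorProduct.assoc K L B A).symm.toLinearMap ∘ₗ LinearMap.lTensor L S) := by
      rw [hcomp]
      exact hT.comp (Ψ.bijective.comp (θB.bijective.comp
        (TensorProduct.assoc K L B B).symm.bijective))
    exact (Function.Bijective.of_comp_iff' (θA.bijective.comp
      (TensorProduct.assoc K L B A).symm.bijective) _).mp h1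
  rw [hS] at hbij
  exact (Module.FaithfullyFlat.lTensor_bijective_iff_bijective K L _).mp hbij

end Orbit

/-! ### Comodules with two commuting coactions -/

section Coaction

variable {K A X Y : Type*} [CommRing K] [AddCommGroup A] [Module K A]
  [AddCommGroup X] [Module K X] [AddCommGroup Y] [Module K Y]

theorem TensorProduct.assoc_rTensor_rTensor {B : Type*} [AddCommGroup B] [Module K B]
    (f : X →ₗ[K] Y) (t : (X ⊗[K] A) ⊗[K] B) :
    TensorProduct.assoc K Y A B (LinearMap.rTensor B (LinearMap.rTensor A f) t) =
      LinearMap.rTensor (A ⊗[K] B) f (TensorProduct.assoc K X A B t) := by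
  refine LinearMap.congr_fun (f := (TensorProduct.assoc K Y A B).toLinearMap ∘ₗ
    LinearMap.rTensor B (LinearMap.rTensor A f))
    (g := LinearMap.rTensor (A ⊗[K] B) f ∘ₗ (TensorProduct.assoc K X A B).toLinearMap) ?_ t
  exact TensorProduct.ext_threefold fun _ _ _ => rfl

theorem TensorProduct.rightComm_rTensor_rTensor {B : Type*} [AddCommGroup B] [Module K B]
    (f : X →ₗ[K] Y) (t : (X ⊗[K] A) ⊗[K] B) :
    TensorProduct.rightComm K Y A B (LinearMap.rTensor B (LinearMap.rTensor A f) t) =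
      LinearMap.rTensor A (LinearMap.rTensor B f) (TensorProduct.rightComm K X A B t) := by
  refine LinearMap.congr_fun (f := (TensorProduct.rightComm K Y A B).toLinearMap ∘ₗ
    LinearMap.rTensor B (LinearMap.rTensor A f))
    (g := LinearMap.rTensor A (LinearMap.rTensor B f) ∘ₗ
      (TensorProduct.rightComm K X A B).toLinearMap) ?_ t
  exact TensorProduct.ext_threefold fun _ _ _ => rfl

theorem LinearMap.lTensor_rTensor_apply {B C : Type*} [AddCommGroup B] [Module K B]
    [AddCommGroup C] [Module K C] (f : X →ₗ[K] Y) (g : B →ₗ[K] C) (t : X ⊗[K] B) :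
    LinearMap.lTensor Y g (LinearMap.rTensor B f t) =
      LinearMap.rTensor C f (LinearMap.lTensor X g t) := by
  induction t using TensorProduct.induction_on with
  | zero => simp
  | add x y hx hy => simp only [map_add, hx, hy]
  | tmul x b => rfl

/-- The coaction `L ⊗ X → (L ⊗ X) ⊗ A` obtained from `F : X → X ⊗ A` by tensoring with `L`. -/
noncomputable def coactionBaseChange (L : Type*) [AddCommGroup L] [Module K L]
    (F : X →ₗ[K] X ⊗[K] A) : L ⊗[K] X →ₗ[K] (L ⊗[K] X) ⊗[K] A :=
  (TensorProduct.assoc K L X A).symm.toLinearMap ∘ₗ LinearMap.lTensor L F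

variable {L : Type*} [AddCommGroup L] [Module K L]

theorem coactionBaseChange_comp_mk (F : X →ₗ[K] X ⊗[K] A) (l : L) :
    coactionBaseChange L F ∘ₗ TensorProduct.mk K L X l =
      LinearMap.rTensor A (TensorProduct.mk K L X l) ∘ₗ F := by
  refine LinearMap.ext fun x => ?_
  simp only [coactionBaseChange, LinearMap.comp_apply, TensorProduct.mk_apply,
    LinearMap.lTensor_tmul]
  induction F x using TensorProduct.induction_on with
  | zero => simp
  | add x y hx hy => simp only [map_add, TensorProduct.tmul_add, hx, hy]
  | tmul x a => rfl

theorem coactionBaseChange_tmul (F : X →ₗ[K] X ⊗[K] A) (l : L) (x : X) :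
    coactionBaseChange L F (l ⊗ₜ x) = LinearMap.rTensor A (TensorProduct.mk K L X l) (F x) :=
  LinearMap.congr_fun (coactionBaseChange_comp_mk F l) x

theorem rTensor_coactionBaseChange_comm {F G : X →ₗ[K] X ⊗[K] A}
    (hFG : ∀ x, LinearMap.rTensor A G (F x) =
      TensorProduct.rightComm K X A A (LinearMap.rTensor A F (G x))) (y : L ⊗[K] X) :
    LinearMap.rTensor A (coactionBaseChange L G) (coactionBaseChange L F y) =
      TensorProduct.rightComm K (L ⊗[K] X) A A
        (LinearMap.rTensor A (coactionBaseChange L F) (coactionBaseChange L G y)) := by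
  induction y using TensorProduct.induction_on with
  | zero => simp
  | add x y hx hy => simp only [map_add, hx, hy]
  | tmul l x =>
    simp only [coactionBaseChange_tmul]
    rw [← LinearMap.rTensor_comp_apply, ← LinearMap.rTensor_comp_apply, coactionBaseChange_comp_mk,
      coactionBaseChange_comp_mk, LinearMap.rTensor_comp_apply, LinearMap.rTensor_comp_apply, hFG,
      TensorProduct.rightComm_rTensor_rTensor]

end Coaction

section Comodule

variable {K A X Y Z : Type*} [CommRing K] [AddCommGroup A] [Module K A] [Coalgebra K A]
  [AddCommGroup X] [Module K X] [AddCommGroup Y] [Module K Y] [AddCommGroup Z] [Module K Z]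

/-- The `K`-linear map `F : X → X ⊗ A` makes `X` a comodule over the coalgebra `A`. -/
structure IsComodule (F : X →ₗ[K] X ⊗[K] A) : Prop where
  coassoc : ∀ x, TensorProduct.assoc K X A A (LinearMap.rTensor A F (F x)) =
    LinearMap.lTensor X Coalgebra.comul (F x)
  counit : ∀ x, TensorProduct.rid K X (LinearMap.lTensor X Coalgebra.counit (F x)) = x

/-- Coassociativity of `F` on the image of a map `f` which intertwines `F` with a comodule
structure. -/
theorem IsComodule.coassoc_map {c : X →ₗ[K] X ⊗[K] A} (hc : IsComodule c) {F : Y →ₗ[K] Y ⊗[K] A}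
    {f : X →ₗ[K] Y} (hf : F ∘ₗ f = LinearMap.rTensor A f ∘ₗ c) (x : X) :
    TensorProduct.assoc K Y A A (LinearMap.rTensor A F (F (f x))) =
      LinearMap.lTensor Y Coalgebra.comul (F (f x)) := by
  have h : F (f x) = LinearMap.rTensor A f (c x) := LinearMap.congr_fun hf x
  rw [h, ← LinearMap.rTensor_comp_apply, hf, LinearMap.rTensor_comp_apply,
    TensorProduct.assoc_rTensor_rTensor, hc.coassoc, LinearMap.lTensor_rTensor_apply]

theorem IsComodule.counit_map {c : X →ₗ[K] X ⊗[K] A} (hc : IsComodule c) {F : Y →ₗ[K] Y ⊗[K] A}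
    {f : X →ₗ[K] Y} (hf : F ∘ₗ f = LinearMap.rTensor A f ∘ₗ c) (x : X) :
    TensorProduct.rid K Y (LinearMap.lTensor Y Coalgebra.counit (F (f x))) = f x := by
  have h : F (f x) = LinearMap.rTensor A f (c x) := LinearMap.congr_fun hf x
  have hrid (t : X ⊗[K] K) : TensorProduct.rid K Y (LinearMap.rTensor K f t) =
      f (TensorProduct.rid K X t) := by
    induction t using TensorProduct.induction_on with
    | zero => simp
    | add x y hx hy => simp only [map_add, hx, hy]
    | tmul x k => simp
  rw [h, LinearMap.lTensor_rTensor_apply, hrid, hc.counit]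

theorem IsComodule.of_lTensor {c : X →ₗ[K] X ⊗[K] A} (hc : IsComodule c)
    {F : Y ⊗[K] X →ₗ[K] (Y ⊗[K] X) ⊗[K] A}
    (hF : ∀ y, F ∘ₗ TensorProduct.mk K Y X y =
      LinearMap.rTensor A (TensorProduct.mk K Y X y) ∘ₗ c) :
    IsComodule F where
  coassoc t := by
    induction t using TensorProduct.induction_on with
    | zero => simp
    | add x y hx hy => simp only [map_add, hx, hy]
    | tmul y x => exact hc.coassoc_map (hF y) x
  counit t := by
    induction t using TensorProduct.induction_on with
    | zero => simp
    | add x y hx hy => simp only [map_add, hx, hy]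
    | tmul y x => exact hc.counit_map (hF y) x

theorem IsComodule.of_rTensor {c : X →ₗ[K] X ⊗[K] A} (hc : IsComodule c)
    {F : X ⊗[K] Y →ₗ[K] (X ⊗[K] Y) ⊗[K] A}
    (hF : ∀ y, F ∘ₗ (TensorProduct.mk K X Y).flip y =
      LinearMap.rTensor A ((TensorProduct.mk K X Y).flip y) ∘ₗ c) :
    IsComodule F where
  coassoc t := by
    induction t using TensorProduct.induction_on with
    | zero => simp
    | add x y hx hy => simp only [map_add, hx, hy]
    | tmul x y => exact hc.coassoc_map (hF y) x
  counit t := by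
    induction t using TensorProduct.induction_on with
    | zero => simp
    | add x y hx hy => simp only [map_add, hx, hy]
    | tmul x y => exact hc.counit_map (hF y) x

/-- Over a cocommutative coalgebra, `x γ γ' = x γ' γ`. -/
theorem IsComodule.rightComm_rTensor [Coalgebra.IsCocomm K A] {F : X →ₗ[K] X ⊗[K] A}
    (hF : IsComodule F) (x : X) :
    TensorProduct.rightComm K X A A (LinearMap.rTensor A F (F x)) =
      LinearMap.rTensor A F (F x) := by
  have h (t : X ⊗[K] A) : TensorProduct.rightComm K X A A ((TensorProduct.assoc K X A A).symm
      (LinearMap.lTensor X Coalgebra.comul t)) =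
      (TensorProduct.assoc K X A A).symm (LinearMap.lTensor X Coalgebra.comul t) := by
    induction t using TensorProduct.induction_on with
    | zero => simp
    | add x y hx hy => simp only [map_add, hx, hy]
    | tmul x a =>
      have h' (u : A ⊗[K] A) : TensorProduct.rightComm K X A A
          ((TensorProduct.assoc K X A A).symm (x ⊗ₜ u)) =
          (TensorProduct.assoc K X A A).symm (x ⊗ₜ TensorProduct.comm K A A u) := by
        induction u using TensorProduct.induction_on with
        | zero => simp
        | add x y hx hy => simp only [map_add, TensorProduct.tmul_add, hx, hy]
        | tmul a b => rfl
      rw [LinearMap.lTensor_tmul, h', Coalgebra.comm_comul]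
  have h2 := h (F x)
  rwa [← hF.coassoc, LinearEquiv.symm_apply_apply] at h2

/-- Let `F` and `G` be commuting coactions on `Y` and let `r : Y → Z` be equivariant for `G`. If
`(r ⊗ 1) ∘ F : Y → Z ⊗ A` is bijective, then `r` maps the elements on which `F` and `G` agree
bijectively onto `Z`. The element over `z` is the preimage of `c z` under `(r ⊗ 1) ∘ F`. -/
theorem IsComodule.bijOn_eqLocus [Coalgebra.IsCocomm K A] {F G : Y →ₗ[K] Y ⊗[K] A}
    {c : Z →ₗ[K] Z ⊗[K] A} (hF : IsComodule F) (hc : IsComodule c)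
    (hFG : ∀ y, LinearMap.rTensor A G (F y) =
      TensorProduct.rightComm K Y A A (LinearMap.rTensor A F (G y)))
    {r : Y →ₗ[K] Z} (hr : ∀ y, LinearMap.rTensor A r (G y) = c (r y))
    (hbij : Function.Bijective (LinearMap.rTensor A r ∘ₗ F)) :
    Set.BijOn r (LinearMap.eqLocus F G) Set.univ := by
  refine ⟨fun _ _ => trivial, fun y hy y' hy' h => hbij.1 ?_, fun z _ => ?_⟩
  · have hy : F y = G y := hy
    have hy' : F y' = G y' := hy'
    rw [LinearMap.comp_apply, LinearMap.comp_apply, hy, hy', hr, hr, h]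
  obtain ⟨y, hy⟩ := hbij.2 (c z)
  have hbij' : Function.Bijective (LinearMap.rTensor A (LinearMap.rTensor A r ∘ₗ F)) :=
    (TensorProduct.congr (LinearEquiv.ofBijective _ hbij) (LinearEquiv.refl K A)).bijective
  have hFr (t : Y) : LinearMap.rTensor A (LinearMap.rTensor A r) (LinearMap.rTensor A F (F t)) =
      (TensorProduct.assoc K Z A A).symm (LinearMap.lTensor Z Coalgebra.comul
        (LinearMap.rTensor A r (F t))) := by
    rw [LinearEquiv.eq_symm_apply, TensorProduct.assoc_rTensor_rTensor, hF.coassoc,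
      LinearMap.lTensor_rTensor_apply]
  have hcr : c ∘ₗ r = LinearMap.rTensor A r ∘ₗ G := LinearMap.ext fun t => (hr t).symm
  have hy' : LinearMap.rTensor A r (F y) = c z := hy
  have hyG : F y = G y := by
    refine hbij'.1 ?_
    have h1 : LinearMap.rTensor A F (G y) =
        TensorProduct.rightComm K Y A A (LinearMap.rTensor A G (F y)) := by
      rw [hFG]
      exact ((TensorProduct.rightComm K Y A A).symm_apply_apply _).symm
    rw [LinearMap.rTensor_comp_apply, LinearMap.rTensor_comp_apply, hFr, hy', h1,
      ← TensorProduct.rightComm_rTensor_rTensor, ← LinearMap.rTensor_comp_apply A _ G, ← hcr,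
      LinearMap.rTensor_comp_apply, hy', hc.rightComm_rTensor, LinearEquiv.symm_apply_eq,
      hc.coassoc]
  refine ⟨y, hyG, ?_⟩
  have h2 := hc.counit (r y)
  rw [← hr, ← hyG, hy', hc.counit] at h2
  exact h2.symm

theorem IsComodule.coactionBaseChange {L : Type*} [AddCommGroup L] [Module K L]
    {F : X →ₗ[K] X ⊗[K] A} (hF : IsComodule F) :
    IsComodule (coactionBaseChange L F) :=
  hF.of_lTensor (coactionBaseChange_comp_mk F)

end Comodule

/-! ### Existence of contracted products -/

namespace GroupTorsor

variable {K A : Type u} [Field K] [CommRing A] [HopfAlgebra K A]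

theorem isComodule (P : GroupTorsor K A) : IsComodule P.coaction.toLinearMap where
  coassoc x := DFunLike.congr_fun P.coaction_coassoc x
  counit x := DFunLike.congr_fun P.coaction_counit x

theorem actFst_comp_mk (P P' : GroupTorsor K A) (b' : P') :
    (actFst P P').toLinearMap ∘ₗ (TensorProduct.mk K P P').flip b' =
      LinearMap.rTensor A ((TensorProduct.mk K P P').flip b') ∘ₗ P.coaction.toLinearMap := by
  refine LinearMap.ext fun b => ?_
  change actFst P P' (b ⊗ₜ b') = LinearMap.rTensor A _ (P.coaction b)
  rw [actFst_tmul]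
  induction P.coaction b using TensorProduct.induction_on with
  | zero => simp
  | add x y hx hy => simp only [map_add, TensorProduct.tmul_add, hx, hy]
  | tmul x a => simp

theorem actSnd_comp_mk (P P' : GroupTorsor K A) (b : P) :
    (actSnd P P').toLinearMap ∘ₗ TensorProduct.mk K P P' b =
      LinearMap.rTensor A (TensorProduct.mk K P P' b) ∘ₗ P'.coaction.toLinearMap := by
  refine LinearMap.ext fun b' => ?_
  change actSnd P P' (b ⊗ₜ b') = LinearMap.rTensor A _ (P'.coaction b')
  rw [actSnd_tmul]
  induction P'.coaction b' using TensorProduct.induction_on with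
  | zero => simp
  | add x y hx hy => simp only [map_add, TensorProduct.tmul_add, hx, hy]
  | tmul x a => simp

theorem isComodule_actFst (P P' : GroupTorsor K A) : IsComodule (actFst P P').toLinearMap :=
  P.isComodule.of_rTensor (actFst_comp_mk P P')

/-- The actions of `Γ` on the two factors of `P × P'` commute. -/
theorem rTensor_actSnd_actFst (P P' : GroupTorsor K A) (t : P ⊗[K] P') :
    LinearMap.rTensor A (actSnd P P').toLinearMap (actFst P P' t) =
      TensorProduct.rightComm K (P ⊗[K] P') A A
        (LinearMap.rTensor A (actFst P P').toLinearMap (actSnd P P' t)) := by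
  induction t using TensorProduct.induction_on with
  | zero => simp
  | add x y hx hy => simp only [map_add, hx, hy]
  | tmul b b' =>
    have h1 : actFst P P' (b ⊗ₜ b') = LinearMap.rTensor A ((TensorProduct.mk K P P').flip b')
        (P.coaction b) := LinearMap.congr_fun (actFst_comp_mk P P' b') b
    have h2 : actSnd P P' (b ⊗ₜ b') = LinearMap.rTensor A (TensorProduct.mk K P P' b)
        (P'.coaction b') := LinearMap.congr_fun (actSnd_comp_mk P P' b) b'
    let ψ (u' : P' ⊗[K] A) : P →ₗ[K] (P ⊗[K] P') ⊗[K] A :=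
      (LinearMap.rTensorHom A ∘ₗ TensorProduct.mk K P P').flip u'
    let φ (u : P ⊗[K] A) : P' →ₗ[K] (P ⊗[K] P') ⊗[K] A :=
      (LinearMap.rTensorHom A ∘ₗ (TensorProduct.mk K P P').flip).flip u
    have hψ : (actSnd P P').toLinearMap ∘ₗ (TensorProduct.mk K P P').flip b' =
        ψ (P'.coaction b') :=
      LinearMap.ext fun x => LinearMap.congr_fun (actSnd_comp_mk P P' x) b'
    have hφ : (actFst P P').toLinearMap ∘ₗ TensorProduct.mk K P P' b = φ (P.coaction b) :=
      LinearMap.ext fun x => LinearMap.congr_fun (actFst_comp_mk P P' x) b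
    have key (u : P ⊗[K] A) (u' : P' ⊗[K] A) : LinearMap.rTensor A (ψ u') u =
        TensorProduct.rightComm K (P ⊗[K] P') A A (LinearMap.rTensor A (φ u) u') := by
      induction u using TensorProduct.induction_on with
      | zero => simp [φ]
      | add x y hx hy =>
        have hxy : φ (x + y) = φ x + φ y := map_add _ x y
        rw [hxy, LinearMap.rTensor_add, LinearMap.add_apply, map_add, map_add, hx, hy]
      | tmul x a =>
        induction u' using TensorProduct.induction_on with
        | zero => simp [ψ]
        | add y z hy hz =>
          have hyz : ψ (y + z) = ψ y + ψ z := map_add _ y z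
          rw [hyz, LinearMap.rTensor_add, LinearMap.add_apply, map_add, map_add, hy, hz]
        | tmul y a' => rfl
    rw [h1, h2, ← LinearMap.rTensor_comp_apply, ← LinearMap.rTensor_comp_apply, hψ, hφ, key]

section ContractedProduct

variable (P P' : GroupTorsor K A)

/-- The coordinate ring of the contracted product: the functions `f` on `P × P'` with
`f (x γ, x') = f (x, x' γ)`. -/
abbrev invariants : Subalgebra K (P ⊗[K] P') := AlgHom.equalizer (actFst P P') (actSnd P P')

theorem exact_invariants : Function.Exact (invariants P P').val.toLinearMap
    ((actFst P P').toLinearMap - (actSnd P P').toLinearMap) := fun t =>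
  ⟨fun h => ⟨⟨t, sub_eq_zero.mp h⟩, rfl⟩, by rintro ⟨s, rfl⟩; exact sub_eq_zero.mpr s.2⟩

theorem map_val_injective : Function.Injective
    (Algebra.TensorProduct.map (invariants P P').val (AlgHom.id K A)) :=
  Module.Flat.rTensor_preserves_injective_linearMap (M := A) (invariants P P').val.toLinearMap
    Subtype.val_injective

/-- The action on the first factor preserves the invariant functions, because `Γ` is commutative.
As `A` is flat, `invariants ⊗ A` consists of the elements equalized by the two actions. -/
theorem actFst_mem_range [Coalgebra.IsCocomm K A] (t : invariants P P') :
    actFst P P' t ∈ (Algebra.TensorProduct.map (invariants P P').val (AlgHom.id K A)).range := by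
  have ht : actFst P P' t = actSnd P P' t := t.2
  have h1 : LinearMap.rTensor A (actSnd P P').toLinearMap (actFst P P' t) =
      LinearMap.rTensor A (actFst P P').toLinearMap (actFst P P' t) := by
    rw [rTensor_actSnd_actFst, ← ht]
    exact (isComodule_actFst P P').rightComm_rTensor _
  refine (Module.Flat.rTensor_exact A (exact_invariants P P') (actFst P P' t)).mp ?_
  rw [LinearMap.rTensor_sub]
  exact sub_eq_zero.mpr h1.symm

/-- The action of `Γ` on the contracted product, induced by the action on the first factor. -/
noncomputable def invariantsCoaction [Coalgebra.IsCocomm K A] :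
    invariants P P' →ₐ[K] invariants P P' ⊗[K] A :=
  (AlgEquiv.ofInjective _ (map_val_injective P P')).symm.toAlgHom.comp
    (((actFst P P').comp (invariants P P').val).codRestrict _ (actFst_mem_range P P'))

theorem map_val_invariantsCoaction [Coalgebra.IsCocomm K A] (t : invariants P P') :
    Algebra.TensorProduct.map (invariants P P').val (AlgHom.id K A) (invariantsCoaction P P' t) =
      actFst P P' t :=
  congrArg Subtype.val ((AlgEquiv.ofInjective _ (map_val_injective P P')).apply_symm_apply _)

theorem isComodule_invariantsCoaction [Coalgebra.IsCocomm K A] :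
    IsComodule (invariantsCoaction P P').toLinearMap where
  coassoc t := by
    let ι := (invariants P P').val.toLinearMap
    have hι : Function.Injective (LinearMap.rTensor (A ⊗[K] A) ι) :=
      Module.Flat.rTensor_preserves_injective_linearMap ι Subtype.val_injective
    have hcomp : LinearMap.rTensor A ι ∘ₗ (invariantsCoaction P P').toLinearMap =
        (actFst P P').toLinearMap ∘ₗ ι := LinearMap.ext (map_val_invariantsCoaction P P')
    have hcomp' (t) : LinearMap.rTensor A ι ((invariantsCoaction P P').toLinearMap t) =
        (actFst P P').toLinearMap (ι t) := LinearMap.congr_fun hcomp t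
    refine hι ?_
    rw [← TensorProduct.assoc_rTensor_rTensor, ← LinearMap.rTensor_comp_apply, hcomp,
      LinearMap.rTensor_comp_apply, hcomp', ← LinearMap.lTensor_rTensor_apply, hcomp',
      (isComodule_actFst P P').coassoc]
  counit t := by
    let ι := (invariants P P').val.toLinearMap
    have hcomp' (t) : LinearMap.rTensor A ι ((invariantsCoaction P P').toLinearMap t) =
        (actFst P P').toLinearMap (ι t) := map_val_invariantsCoaction P P' t
    have hrid (t : invariants P P' ⊗[K] K) : TensorProduct.rid K _ (LinearMap.rTensor K ι t) =
        ι (TensorProduct.rid K _ t) := by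
      induction t using TensorProduct.induction_on with
      | zero => simp
      | add x y hx hy => simp only [map_add, hx, hy]
      | tmul x k => simp
    refine Subtype.val_injective ?_
    change ι _ = ι _
    rw [← hrid, ← LinearMap.lTensor_rTensor_apply, hcomp', (isComodule_actFst P P').counit]

section Point

variable {P P'} {L : Type u} [CommRing L] [Algebra K L] (σ : P →ₐ[K] L) (σ' : P' →ₐ[K] L)

/-- The restriction of functions on `P × P'` to `{σ} × P'`: the map `L ⊗ (P ⊗ P') → L ⊗ P'`,
`l ⊗ (b ⊗ b') ↦ l σ(b) ⊗ b'`. -/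
noncomputable def restrictFst (P' : GroupTorsor K A) :
    L ⊗[K] (P ⊗[K] P') →ₗ[K] L ⊗[K] P' :=
  LinearMap.rTensor P' (LinearMap.mul' K L ∘ₗ LinearMap.lTensor L σ.toLinearMap) ∘ₗ
    (TensorProduct.assoc K L P P').symm.toLinearMap

theorem restrictFst_tmul (P' : GroupTorsor K A) (l : L) (b : P) (b' : P') :
    restrictFst σ P' (l ⊗ₜ (b ⊗ₜ b')) = (l * σ b) ⊗ₜ b' := rfl

theorem rTensor_restrictFst_actSnd (y : L ⊗[K] (P ⊗[K] P')) :
    LinearMap.rTensor A (restrictFst σ P') (coactionBaseChange L (actSnd P P').toLinearMap y) =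
      coactionBaseChange L P'.coaction.toLinearMap (restrictFst σ P' y) := by
  induction y using TensorProduct.induction_on with
  | zero => simp
  | add x y hx hy => simp only [map_add, hx, hy]
  | tmul l t =>
    induction t using TensorProduct.induction_on with
    | zero => simp
    | add x y hx hy => simp only [map_add, TensorProduct.tmul_add, hx, hy]
    | tmul b b' =>
      have h2 : (actSnd P P').toLinearMap (b ⊗ₜ b') =
          LinearMap.rTensor A (TensorProduct.mk K P P' b) (P'.coaction.toLinearMap b') :=
        LinearMap.congr_fun (actSnd_comp_mk P P' b) b'
      rw [coactionBaseChange_tmul, h2, restrictFst_tmul, coactionBaseChange_tmul,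
        ← LinearMap.rTensor_comp_apply, ← LinearMap.rTensor_comp_apply]
      rfl

/-- A function `f` on `(P × P')_L` amounts to the function `(x', γ) ↦ f (σ γ, x')`. -/
theorem bijective_rTensor_restrictFst_actFst : Function.Bijective
    (LinearMap.rTensor A (restrictFst σ P') ∘ₗ
      coactionBaseChange L (actFst P P').toLinearMap) := by
  let θ : (L ⊗[K] P) ⊗[K] P' ≃ₗ[K] (L ⊗[K] A) ⊗[K] P' :=
    TensorProduct.congr ((P.orbitEquiv σ).toLinearEquiv.restrictScalars K) (LinearEquiv.refl K P')
  let e := (TensorProduct.assoc K L P P').symm ≪≫ₗ θ ≪≫ₗ TensorProduct.rightComm K L A P'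
  suffices h : LinearMap.rTensor A (restrictFst σ P') ∘ₗ
      coactionBaseChange L (actFst P P').toLinearMap = e.toLinearMap by
    rw [h]
    exact e.bijective
  refine TensorProduct.ext' fun l t => ?_
  induction t using TensorProduct.induction_on with
  | zero => simp only [TensorProduct.tmul_zero, map_zero]
  | add x y hx hy => simp only [map_add, TensorProduct.tmul_add, hx, hy]
  | tmul b b' =>
    have h1 : (actFst P P').toLinearMap (b ⊗ₜ b') =
        LinearMap.rTensor A ((TensorProduct.mk K P P').flip b') (P.coaction b) :=
      LinearMap.congr_fun (actFst_comp_mk P P' b') b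
    have h2 : e (l ⊗ₜ (b ⊗ₜ b')) =
        TensorProduct.rightComm K L A P' (P.orbitEquiv σ (l ⊗ₜ b) ⊗ₜ b') := rfl
    rw [LinearMap.comp_apply, coactionBaseChange_tmul, h1, LinearEquiv.coe_coe, h2,
      orbitEquiv_tmul, orbitMap_apply]
    induction P.coaction b using TensorProduct.induction_on with
    | zero => simp
    | add x y hx hy => simp only [map_add, smul_add, TensorProduct.add_tmul, hx, hy]
    | tmul x a => simp [TensorProduct.smul_tmul', restrictFst_tmul]

theorem bijOn_restrictFst [Coalgebra.IsCocomm K A] : Set.BijOn (restrictFst σ P')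
    (LinearMap.eqLocus (coactionBaseChange L (actFst P P').toLinearMap)
      (coactionBaseChange L (actSnd P P').toLinearMap)) Set.univ :=
  (isComodule_actFst P P').coactionBaseChange.bijOn_eqLocus P'.isComodule.coactionBaseChange
    (rTensor_coactionBaseChange_comm (rTensor_actSnd_actFst P P'))
    (rTensor_restrictFst_actSnd σ) (bijective_rTensor_restrictFst_actFst σ)

/-- Over `L`, the contracted product of `P` and `P'` becomes isomorphic to `P'`. -/
theorem bijective_restrictFst_comp [Coalgebra.IsCocomm K A] : Function.Bijective
    (restrictFst σ P' ∘ₗ LinearMap.lTensor L (invariants P P').val.toLinearMap) := by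
  let ι := (invariants P P').val.toLinearMap
  have hι : Function.Injective (LinearMap.lTensor L ι) :=
    Module.Flat.lTensor_preserves_injective_linearMap ι Subtype.val_injective
  have hmem (y : L ⊗[K] (P ⊗[K] P')) :
      y ∈ LinearMap.eqLocus (coactionBaseChange L (actFst P P').toLinearMap)
        (coactionBaseChange L (actSnd P P').toLinearMap) ↔
          y ∈ Set.range (LinearMap.lTensor L ι) := by
    rw [← Module.Flat.lTensor_exact L (exact_invariants P P') y, LinearMap.lTensor_sub,
      LinearMap.sub_apply, sub_eq_zero]
    exact (TensorProduct.assoc K L (P ⊗[K] P') A).symm.injective.eq_iff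
  obtain ⟨-, h1, h2⟩ := bijOn_restrictFst (P' := P') σ
  refine ⟨fun x y hxy => hι (h1 ((hmem _).mpr ⟨x, rfl⟩) ((hmem _).mpr ⟨y, rfl⟩) hxy), fun z => ?_⟩
  obtain ⟨y, hy, rfl⟩ := h2 (Set.mem_univ z)
  obtain ⟨x, rfl⟩ := (hmem y).mp hy
  exact ⟨x, rfl⟩

theorem bijective_orbitBaseChange_invariants [Coalgebra.IsCocomm K A] : Function.Bijective
    (orbitBaseChange (invariantsCoaction P P')
      ((prodPoint σ σ').comp (invariants P P').val)) := by
  have h (y : L ⊗[K] invariants P P') : orbitBaseChange (invariantsCoaction P P')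
      ((prodPoint σ σ').comp (invariants P P').val) y =
      P'.orbitEquiv σ' (restrictFst σ P'
        (LinearMap.lTensor L (invariants P P').val.toLinearMap y)) := by
    induction y using TensorProduct.induction_on with
    | zero => simp
    | add x y hx hy => simp only [map_add, hx, hy]
    | tmul l t =>
      have ht : actFst P P' t = actSnd P P' t := t.2
      rw [orbitBaseChange_tmul, Algebra.TensorProduct.map_comp_id_apply,
        map_val_invariantsCoaction, ht]
      change _ = P'.orbitEquiv σ' (restrictFst σ P' (l ⊗ₜ (t : P ⊗[K] P')))
      induction (t : P ⊗[K] P') using TensorProduct.induction_on with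
      | zero => simp
      | add x y hx hy => simp only [map_add, smul_add, TensorProduct.tmul_add, hx, hy]
      | tmul b b' => rw [map_prodPoint_actSnd, restrictFst_tmul, orbitEquiv_tmul, mul_smul]
  rw [show ⇑(orbitBaseChange (invariantsCoaction P P')
      ((prodPoint σ σ').comp (invariants P P').val)) = P'.orbitEquiv σ' ∘
        (restrictFst σ P' ∘ₗ LinearMap.lTensor L (invariants P P').val.toLinearMap) from funext h]
  exact (P'.orbitEquiv σ').bijective.comp (bijective_restrictFst_comp σ)

end Point

/-- Any two torsors which both have a point over some `L` have a contracted product. -/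
theorem exists_isSum [Coalgebra.IsCocomm K A] {L : Type u} [CommRing L] [Nontrivial L] [Algebra K L]
    (σ : P →ₐ[K] L) (σ' : P' →ₐ[K] L) : ∃ Q : GroupTorsor K A, IsSum P P' Q := by
  have hco : (Algebra.TensorProduct.assoc K K K (invariants P P') A A).toAlgHom.comp
      ((Algebra.TensorProduct.map (invariantsCoaction P P') (AlgHom.id K A)).comp
        (invariantsCoaction P P')) =
      (Algebra.TensorProduct.map (AlgHom.id K _) (Bialgebra.comulAlgHom K A)).comp
        (invariantsCoaction P P') :=
    AlgHom.ext (isComodule_invariantsCoaction P P').coassoc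
  have hnt : Nontrivial (P ⊗[K] P') := inferInstance
  refine ⟨{ carrier := invariants P P'
            coaction := invariantsCoaction P P'
            coaction_coassoc := hco
            coaction_counit := AlgHom.ext (isComodule_invariantsCoaction P P').counit
            bijective_shear := bijective_shear_of_orbitBaseChange hco
              ((prodPoint σ σ').comp (invariants P P').val)
              (bijective_orbitBaseChange_invariants σ σ') },
    (invariants P P').val, Subtype.val_injective, fun t => ?_,
    AlgHom.ext fun t => (map_val_invariantsCoaction P P' t).symm⟩
  exact ⟨by rintro ⟨s, rfl⟩; exact s.2, fun h => ⟨⟨t, h⟩, rfl⟩⟩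

end ContractedProduct

theorem IsSum.of_iso {P P' Q R : GroupTorsor K A} (h : IsSum P P' Q) (hQR : Q.Iso R) :
    IsSum P P' R := by
  obtain ⟨e, he⟩ := (setoid K A).symm hQR
  obtain ⟨q, hq, hrange, hco⟩ := h
  refine ⟨q.comp e.toAlgHom, hq.comp e.injective, fun t => ?_, ?_⟩
  · rw [← hrange]
    exact ⟨by rintro ⟨s, rfl⟩; exact ⟨e s, rfl⟩, by rintro ⟨s, rfl⟩; exact
      ⟨e.symm s, congrArg q (e.apply_symm_apply s)⟩⟩
  · rw [← AlgHom.comp_assoc, hco, AlgHom.comp_assoc, he]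
    exact AlgHom.ext fun t => (Algebra.TensorProduct.map_comp_id_apply _ _ _).symm

end GroupTorsor

/-! ### The group structure on isomorphism classes of torsors -/

/-- A non-empty subset closed under addition of an abelian group killed by `n > 0` is a subgroup;
its group structure is transported along an injection onto it. -/
theorem exists_addCommGroup_of_injective {H V : Type*} [AddCommGroup V] [Nonempty H] {n : ℕ}
    (hn : 0 < n) (hV : ∀ v : V, n • v = 0) {f : H → V} (hf : Function.Injective f)
    (hadd : ∀ x y, ∃ z, f z = f x + f y) :
    ∃ _inst : AddCommGroup H, ∃ Φ : H →+ V, ⇑Φ = f := by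
  have hsmul (x : H) (m : ℕ) : ∃ z, f z = (m + 1) • f x := by
    induction m with
    | zero => exact ⟨x, by simp⟩
    | succ m ih =>
      obtain ⟨z, hz⟩ := ih
      obtain ⟨w, hw⟩ := hadd z x
      exact ⟨w, by rw [hw, hz, succ_nsmul _ (m + 1)]⟩
  let S : AddSubgroup V :=
    { carrier := Set.range f
      add_mem' := by
        rintro _ _ ⟨x, rfl⟩ ⟨y, rfl⟩
        exact hadd x y
      zero_mem' := by
        obtain ⟨z, hz⟩ := hsmul (Classical.arbitrary H) (n - 1)
        exact ⟨z, by rw [hz, Nat.sub_add_cancel hn, hV]⟩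
      neg_mem' := by
        rintro _ ⟨x, rfl⟩
        -- `-v = (2 n - 1) • v`, where the coefficient is positive.
        obtain ⟨z, hz⟩ := hsmul x (2 * n - 2)
        refine ⟨z, eq_neg_of_add_eq_zero_left ?_⟩
        rw [hz, ← succ_nsmul, show 2 * n - 2 + 1 + 1 = 2 * n by omega, mul_comm, mul_nsmul, hV,
          smul_zero] }
  let e : H ≃ S := Equiv.ofInjective f hf
  let inst : AddCommGroup H := e.addCommGroup
  refine ⟨inst, S.subtype.comp (e.addEquiv).toAddMonoidHom, rfl⟩

namespace GroupTorsor

variable {p : ℕ} [Fact p.Prime] {K : Type u} [Field K] [CharP K p] {A : Type u} [CommRing A]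
  [HopfAlgebra K A]

/-- The unique `K`-morphism `Spec K^[1] → P`. -/
noncomputable def frobeniusPoint (hA : IsHeightOne p K A) (P : GroupTorsor K A) :
    P →ₐ[K] FrobTwist p K := (exists_unique_section hA P).choose

theorem eq_frobeniusPoint (hA : IsHeightOne p K A) {P : GroupTorsor K A}
    (τ : P →ₐ[K] FrobTwist p K) :
    τ = P.frobeniusPoint hA := (exists_unique_section hA P).choose_spec τ

/-- The map `[P] ↦ ξ_P` on `H¹(K, Γ)`, where `ξ_P` is the differential of the Frobenius point of
`P`. -/
noncomputable def H1.differential (hA : IsHeightOne p K A) :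
    H1 K A → (FrobTwist p K ⊗[K] CoLie K A →ₗ[FrobTwist p K] Ω[FrobTwist p K⁄K]) :=
  Quotient.lift (fun P => P.differential (P.frobeniusPoint hA)) fun _ _ ⟨_, he⟩ =>
    differential_eq_of_iso _ _ he (eq_frobeniusPoint hA _)

theorem H1.differential_toH1 (hA : IsHeightOne p K A) (P : GroupTorsor K A)
    (σ : P →ₐ[K] FrobTwist p K) : H1.differential hA P.toH1 = P.differential σ := by
  rw [eq_frobeniusPoint hA σ]
  rfl

theorem H1.differential_injective (hA : IsHeightOne p K A) :
    Function.Injective (H1.differential hA) := by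
  rintro ⟨P⟩ ⟨Q⟩ h
  exact Quotient.sound (iso_of_differential_eq (fun x hx =>
    KaehlerDifferential.mem_range_algebraMap_of_D_eq_zero p (FrobTwist.pow_mem_range p) hx) _ _ h)

theorem H1.differential_of_isSum (hA : IsHeightOne p K A) {P P' Q : GroupTorsor K A}
    (h : IsSum P P' Q) : H1.differential hA Q.toH1 =
      H1.differential hA P.toH1 + H1.differential hA P'.toH1 := by
  obtain ⟨q, -, hrange, hq⟩ := h
  rw [H1.differential_toH1 hA P (P.frobeniusPoint hA),
    H1.differential_toH1 hA P' (P'.frobeniusPoint hA), H1.differential_toH1 hA Q]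
  exact GroupTorsor.differential_of_isSum (fun t => (hrange _).mp ⟨t, rfl⟩) hq _ _

theorem H1.exists_differential_eq_add [Coalgebra.IsCocomm K A] (hA : IsHeightOne p K A)
    (x y : H1 K A) : ∃ z, H1.differential hA z = H1.differential hA x + H1.differential hA y := by
  obtain ⟨P, rfl⟩ := Quotient.exists_rep x
  obtain ⟨P', rfl⟩ := Quotient.exists_rep y
  obtain ⟨Q, hQ⟩ := exists_isSum P P' (P.frobeniusPoint hA) (P'.frobeniusPoint hA)
  exact ⟨Q.toH1, H1.differential_of_isSum hA hQ⟩

/-- As the differential is injective, the contracted product is determined up to isomorphism by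
the sum of the differentials. -/
theorem isSum_iff_differential [Coalgebra.IsCocomm K A] (hA : IsHeightOne p K A)
    {P P' Q : GroupTorsor K A} : IsSum P P' Q ↔ H1.differential hA P.toH1 +
      H1.differential hA P'.toH1 = H1.differential hA Q.toH1 := by
  refine ⟨fun h => (H1.differential_of_isSum hA h).symm, fun h => ?_⟩
  obtain ⟨R, hR⟩ := exists_isSum P P' (P.frobeniusPoint hA) (P'.frobeniusPoint hA)
  have hRQ := H1.differential_injective hA ((H1.differential_of_isSum hA hR).trans h)
  exact hR.of_iso (Quotient.exact hRQ)

end GroupTorsor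

/-- Let `K` be a finitely generated extension of a perfect field `k₀` of characteristic `p` and let
`Γ = Spec A` be a commutative finite group scheme of height one over `K`. Then
`Ω_{K^[1]/k₀} → Ω_{F_K}` is an isomorphism; every `Γ`-torsor `P` over `K` has a unique Frobenius
section `σ` (a `K`-morphism `Spec K^[1] → P`, i.e. `σ : Spec K → P` lying over `F_K`); the
canonical map `σ^* Ω_{P/K} → F_K^* ω_Γ` is an isomorphism; `H¹(K, Γ)` is a commutative group under
the contracted product of torsors; and there is an injective group homomorphism
`Φ : H¹(K, Γ) → Hom_K(F_K^* ω_Γ, Ω_{K^[1]/k₀})` such that, under the two identifications above,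
`Φ(P)` is the morphism of differentials `σ^* Ω_{P/K} → Ω_{F_K}` induced by `σ`. -/
theorem proposition1p1 (p : ℕ) [Fact p.Prime]
    (k₀ : Type*) [Field k₀] [CharP k₀ p] [PerfectField k₀]
    (K : Type u) [Field K] [CharP K p] [Algebra k₀ K]
    (hK : (⊤ : IntermediateField k₀ K).FG)
    (A : Type u) [CommRing A] [HopfAlgebra K A] [Coalgebra.IsCocomm K A]
    (hA : IsHeightOne p K A) :
    Function.Bijective
        (KaehlerDifferential.map k₀ K (FrobTwist p K) (FrobTwist p K)) ∧
    (∀ P : GroupTorsor K A, ∃ σ : P →ₐ[K] FrobTwist p K,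
      (∀ τ : P →ₐ[K] FrobTwist p K, τ = σ) ∧ Function.Bijective (P.trivialization σ)) ∧
    ∃ _inst : AddCommGroup (GroupTorsor.H1 K A),
      (∀ P P' Q : GroupTorsor K A, P.toH1 + P'.toH1 = Q.toH1 ↔ GroupTorsor.IsSum P P' Q) ∧
      ∃ Φ : GroupTorsor.H1 K A →+
          (FrobTwist p K ⊗[K] CoLie K A →ₗ[FrobTwist p K] Ω[FrobTwist p K⁄k₀]),
        Function.Injective Φ ∧
        ∀ (P : GroupTorsor K A) (σ : P →ₐ[K] FrobTwist p K) (w : PullbackDiff σ),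
          KaehlerDifferential.map k₀ K (FrobTwist p K) (FrobTwist p K)
              (Φ P.toH1 (P.trivialization σ w)) =
            PullbackDiff.toDiff σ w := by
  have hmap := FrobTwist.map_kaehlerDifferential_bijective p (K := K) k₀
  refine ⟨hmap, fun P => ⟨P.frobeniusPoint hA, GroupTorsor.eq_frobeniusPoint hA,
    P.trivialization_bijective _⟩, ?_⟩
  have : Nonempty (GroupTorsor.H1 K A) := ⟨(GroupTorsor.trivialTorsor K A).toH1⟩
  obtain ⟨inst, Ψ, hΨ⟩ := exists_addCommGroup_of_injective (n := p) (Nat.Prime.pos Fact.out)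
    (fun v => by rw [← Nat.cast_smul_eq_nsmul (FrobTwist p K), CharP.cast_eq_zero, zero_smul])
    (GroupTorsor.H1.differential_injective hA) (GroupTorsor.H1.exists_differential_eq_add hA)
  have hΨ_inj : Function.Injective Ψ := hΨ ▸ GroupTorsor.H1.differential_injective hA
  let e := LinearEquiv.ofBijective _ hmap
  refine ⟨inst, fun P P' Q => ?_,
    (LinearMap.compRight (FrobTwist p K) e.symm.toLinearMap).toAddMonoidHom.comp Ψ, ?_,
    fun P σ w => ?_⟩
  · rw [GroupTorsor.isSum_iff_differential hA, ← hΨ, ← map_add, hΨ_inj.eq_iff]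
  · intro x y h
    exact hΨ_inj (LinearMap.ext fun v => e.symm.injective (LinearMap.congr_fun h v))
  · have h1 := P.differential_trivialization σ w
    rw [← GroupTorsor.H1.differential_toH1 hA P σ, ← hΨ] at h1
    exact (e.apply_symm_apply _).trans h1
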